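/- **Proposition 3.1 (Unique solvability).** Let $d\ge 2$ and let $\Omega\subset\mathbb R^d$ be a polygonal/polyhedral domain: a nonempty connected open set with $\operatorname{int}\overline\Omega=\Omega$, equipped with a conforming partition $\mathcal T_h$ into finitely many nondegenerate $d$-simplices $K$ (triangles if $d=2$, tetrahedra if $d=3$), i.e. $\overline\Omega=\bigcup_{K}\overline K$ and any two closed elements meet exactly in the (possibly empty) simplex spanned by their common vertices. Let $\Gamma=\partial\Omega$, let $\mathcal E(K)$ be the set of faces of $K$, let $\mathcal E_h=\bigcup_K\mathcal E(K)$, and let $\mathbf n$ be the unit outward normal on each $\partial K$. Let $\kappa\in L^\infty(\Omega)$ be bounded below by a positive constant a.e., $f\in L^2(\Omega)$, $u_0\in L^2(\Gamma)$. Let $k\ge 0$ be an integer, $\mathcal P_k$ the polynomials of degree at most $k$, $\widetilde{\mathcal P}_k$ the homogeneous polynomials of degree $k$, $\mathcal{RT}_k(K)=\mathcal P_k(K)^d\oplus \mathbf x\,\widetilde{\mathcal P}_k(K)$, and $$\mathbf V_h=\prod_{K}\mathcal{RT}_k(K),\quad W_h=\prod_{K}\mathcal P_k(K),\quad M_h=\prod_{e\in\mathcal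 E_h}\mathcal P_k(e),\quad \mathbf V_h^{\mathrm{div}}=\mathbf V_h\cap\mathbf H(\mathrm{div},\Omega),$$ $$M_h^\circ=\{\mu\in M_h:\mu|_e=0\ \forall e\subset\Gamma\},\qquad M_h^\Gamma=\{\mu\in M_h:\mu|_e=0\ \forall e\not\subset\Gamma\},$$ where elements of $\mathbf V_h$ and $W_h$ are also regarded as functions defined almost everywhere on $\Omega$. Write $(a,b)_D=\int_D ab$ (with the dot product for vector fields), $(a,b)_{\mathcal T_h}=\sum_K(a,b)_K$ with differential operators applied element by element, $\langle\lambda,\mu\rangle_S=\int_S\lambda\mu$ (surface integral), $\langle\mathbf q\cdot\mathbf n,\mu\rangle_{\partial\mathcal T_h}=\sum_K\langle\mathbf q|_K\cdot\mathbf n,\mu\rangle_{\partial K}$ and $\langle\mathbf q\cdot\mathbf n,\mu\rangle_{\partial\mathcal T_h\setminus\Gamma}=\sum_K\langle\mathbf q|_K\cdot\mathbf n,\mu\rangle_{\partial K\setminus\Gamma}$. The hybridized system (H) is: find $(\mathbf q_h,u_h,\widehat u_h)\in\mathbf V_h\times W_h\times M_h$ such that $$\begin{aligned} (\kappa^{-1}\mathbf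 q_h,\mathbf r)_{\mathcal T_h}-(u_h,\mathrm{div}\,\mathbf r)_{\mathcal T_h}+\langle\widehat u_h,\mathbf r\cdot\mathbf n\rangle_{\partial\mathcal T_h}&=0 &&\forall\mathbf r\in\mathbf V_h,\\ (\mathrm{div}\,\mathbf q_h,w)_{\mathcal T_h}&=(f,w)_{\mathcal T_h}&&\forall w\in W_h,\\ \langle\mathbf q_h\cdot\mathbf n,\mu\rangle_{\partial\mathcal T_h\setminus\Gamma}&=0&&\forall\mu\in M_h^\circ,\\ \langle\widehat u_h,\mu\rangle_\Gamma&=\langle u_0,\mu\rangle_\Gamma&&\forall\mu\in M_h^\Gamma. \end{aligned}$$ The Galerkin system (G) is: find $(\mathbf q_h,u_h)\in\mathbf V_h^{\mathrm{div}}\times W_h$ such that $$\begin{aligned} (\kappa^{-1}\mathbf q_h,\mathbf r)_\Omega-(u_h,\mathrm{div}\,\mathbf r)_\Omega&=-\langle u_0,\mathbf r\cdot\mathbf n\rangle_\Gamma&&\forall\mathbf r\in\mathbf V_h^{\mathrm{div}},\\ (\mathrm{div}\,\mathbf q_h,v)_\Omega&=(f,v)_\Omega&&\forall v\in W_h. \end{aligned}$$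 Then: (a) system (H) has exactly one solution; (b) if $(\mathbf q_h,u_h,\widehat u_h)$ solves (H), then $(\mathbf q_h,u_h)$ solves (G) (in particular $\mathbf q_h\in\mathbf V_h^{\mathrm{div}}$); (c) if $(\mathbf q_h,u_h)$ solves (G), then there is $\widehat u_h\in M_h$ such that $(\mathbf q_h,u_h,\widehat u_h)$ solves (H). -/

import Mathlib

open MeasureTheory Set
open scoped ContDiff

noncomputable section

namespace RTHybrid

/-- The Euclidean space `ℝ^d`. -/
abbrev Space (d : ℕ) : Type := EuclideanSpace ℝ (Fin d)

/-- The closed simplex spanned by a finite set of vertices. -/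
abbrev hull {d : ℕ} (s : Finset (Space d)) : Set (Space d) :=
  convexHull ℝ (s : Set (Space d))

/-- The open simplex: the interior in `ℝ^d` of the closed one. -/
def cell {d : ℕ} (K : Finset (Space d)) : Set (Space d) := interior (hull K)

/-- A conforming partition of `Ω ⊆ ℝ^d` into finitely many nondegenerate `d`-simplices
(triangles for `d = 2`, tetrahedra for `d = 3`). An element is given by its set of `d + 1`
vertices. Two closed elements meet only in the face spanned by their common vertices (nothing
if there is none), and the closed elements cover the closure of `Ω`. -/
structure Triangulation {d : ℕ} (Ω : Set (Space d)) where
  /-- the elements, as sets of vertices -/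
  elems : Finset (Finset (Space d))
  card_eq : ∀ K ∈ elems, K.card = d + 1
  indep : ∀ K ∈ elems, AffineIndependent ℝ (fun x : K => (x : Space d))
  conforming : ∀ K ∈ elems, ∀ L ∈ elems,
    hull K ∩ hull L ⊆ convexHull ℝ ((K : Set (Space d)) ∩ (L : Set (Space d)))
  cover : ⋃ K ∈ elems, hull K = closure Ω

open Classical in
/-- The set of all faces (edges for `d = 2`) of the elements: the `d`-point subsets of the vertex
sets of the elements. A face shared by two elements occurs once. -/
def Triangulation.faces {d : ℕ} {Ω : Set (Space d)} (T : Triangulation Ω) :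
    Finset (Finset (Space d)) :=
  T.elems.biUnion fun K => K.powersetCard d

/-! ### Normal vectors -/

/-- The barycenter of a finite set of points. -/
def barycenter {d : ℕ} (s : Finset (Space d)) : Space d :=
  (s.card : ℝ)⁻¹ • ∑ x ∈ s, x

/-- The unit normal to the face `e` of the simplex `K`, exterior to `K`: the component orthogonal
to the hyperplane of `e` of the vector from the barycenter of `K` to the barycenter of `e`,
normalized. -/
def outwardNormal {d : ℕ} (K e : Finset (Space d)) : Space d :=
  NormedSpace.normalize
    ((vectorSpan ℝ (e : Set (Space d)))ᗮ.starProjection (barycenter e - barycenter K))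

/-! ### Polynomial spaces -/

/-- Polynomials in `d` variables. -/
abbrev Poly (d : ℕ) : Type := MvPolynomial (Fin d) ℝ

/-- The space `P_k` of polynomials of total degree at most `k`. Polynomials on a nondegenerate
simplex are identified with polynomials. -/
def Pk (d k : ℕ) : Submodule ℝ (Poly d) := MvPolynomial.restrictTotalDegree (Fin d) ℝ k

/-- Multiplication of a scalar polynomial by the vector field `m(x) = x`. -/
def mulPosition (d : ℕ) : Poly d →ₗ[ℝ] (Fin d → Poly d) :=
  LinearMap.pi fun i => LinearMap.mulLeft ℝ (MvPolynomial.X i)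

/-- The Raviart-Thomas space `RT_k = (P_k)^d + m P̃_k`, where `P̃_k` are the homogeneous
polynomials of degree `k`. -/
def RT (d k : ℕ) : Submodule ℝ (Fin d → Poly d) :=
  Submodule.pi Set.univ (fun _ => Pk d k) ⊔
    (MvPolynomial.homogeneousSubmodule (Fin d) ℝ k).map (mulPosition d)

/-- The value at a point, as a linear functional on polynomials. -/
def evalAt {d : ℕ} (x : Space d) : Poly d →ₗ[ℝ] ℝ :=
  (MvPolynomial.aeval (fun i => x i) : Poly d →ₐ[ℝ] ℝ).toLinearMap

/-- The value at a point of a polynomial vector field. -/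
def vecEvalAt {d : ℕ} (x : Space d) (q : Fin d → Poly d) : Space d :=
  WithLp.toLp 2 fun i => evalAt x (q i)

/-- The divergence of a polynomial vector field. -/
def polyDiv {d : ℕ} (q : Fin d → Poly d) : Poly d := ∑ i, MvPolynomial.pderiv i (q i)

/-- The space `P_k(e)`, as a space of functions on the (closed) face `e`. Restrictions to a
hyperplane of polynomials of degree at most `k` in `d` variables are the polynomials of degree at
most `k` in `d - 1` tangential coordinates. -/
def facePk {d : ℕ} (k : ℕ) (e : Finset (Space d)) : Submodule ℝ (hull e → ℝ) :=
  (Pk d k).map (LinearMap.pi fun x : hull e => evalAt (x : Space d))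

section Discrete

variable {d : ℕ} {Ω : Set (Space d)}

/-- `V_h = ∏_K RT_k(K)`. -/
abbrev Vh (T : Triangulation Ω) (k : ℕ) : Type := ∀ _ : T.elems, RT d k

/-- `W_h = ∏_K P_k(K)`. -/
abbrev Wh (T : Triangulation Ω) (k : ℕ) : Type := ∀ _ : T.elems, Pk d k

/-- `M_h = ∏_e P_k(e)`. -/
abbrev Mh (T : Triangulation Ω) (k : ℕ) : Type := ∀ e : T.faces, facePk k e.1

/-- A face lies on the boundary `Γ = ∂Ω`; otherwise it is an interior face. -/
def OnBoundary (Ω : Set (Space d)) (e : Finset (Space d)) : Prop := hull e ⊆ frontier Ω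

/-- `M_h° = {μ ∈ M_h : μ = 0 on Γ}`. -/
def MhInterior (T : Triangulation Ω) (k : ℕ) : Set (Mh T k) :=
  {μ | ∀ e : T.faces, OnBoundary Ω e.1 → μ e = 0}

/-- `M_h^Γ = {μ ∈ M_h : μ = 0 on every interior face}`. -/
def MhBoundary (T : Triangulation Ω) (k : ℕ) : Set (Mh T k) :=
  {μ | ∀ e : T.faces, ¬ OnBoundary Ω e.1 → μ e = 0}

/-- The surface integral over a face of a function on that face, with respect to the
`(d-1)`-dimensional surface measure. -/
def faceIntegral (e : Finset (Space d)) (g : hull e → ℝ) : ℝ :=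
  ∫ x, g x ∂(Measure.comap Subtype.val (μHE[d - 1] : Measure (Space d)))

/-- The normal component on the face `e` of the element `K` of a polynomial vector field. -/
def normalTrace (K e : Finset (Space d)) (q : Fin d → Poly d) (x : Space d) : ℝ :=
  inner ℝ (vecEvalAt x q) (outwardNormal K e)

/-! ### The forms of the hybridized system -/

/-- `(κ⁻¹ q, r)_{T_h}` -/
def massForm {T : Triangulation Ω} {k : ℕ} (κ : Space d → ℝ) (q r : Vh T k) : ℝ :=
  ∑ K : T.elems, ∫ x in cell K.1,
    (κ x)⁻¹ * inner ℝ (vecEvalAt x (q K).1) (vecEvalAt x (r K).1)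

/-- `(w, div q)_{T_h}`, with the divergence taken element by element -/
def divForm {T : Triangulation Ω} {k : ℕ} (w : Wh T k) (q : Vh T k) : ℝ :=
  ∑ K : T.elems, ∫ x in cell K.1, evalAt x (w K).1 * evalAt x (polyDiv (q K).1)

/-- `(f, w)_{T_h}` -/
def loadForm {T : Triangulation Ω} {k : ℕ} (f : Space d → ℝ) (w : Wh T k) : ℝ :=
  ∑ K : T.elems, ∫ x in cell K.1, f x * evalAt x (w K).1

open Classical in
/-- `⟨μ, q·n⟩_{∂T_h}`: sum over all elements of the integral over the whole boundary -/
def traceForm {T : Triangulation Ω} {k : ℕ} (μ : Mh T k) (q : Vh T k) : ℝ :=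
  ∑ K : T.elems, ∑ e : T.faces with e.1 ⊆ K.1,
    faceIntegral e.1 fun x => (μ e).1 x * normalTrace K.1 e.1 (q K).1 x

open Classical in
/-- `⟨q·n, μ⟩_{∂T_h ∖ Γ}`: the same sum without the boundary faces -/
def interiorTraceForm {T : Triangulation Ω} {k : ℕ} (q : Vh T k) (μ : Mh T k) : ℝ :=
  ∑ K : T.elems, ∑ e : T.faces with e.1 ⊆ K.1 ∧ ¬ OnBoundary Ω e.1,
    faceIntegral e.1 fun x => normalTrace K.1 e.1 (q K).1 x * (μ e).1 x

open Classical in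
/-- `⟨lam, μ⟩_Γ` for two discrete functions on the skeleton -/
def boundaryForm {T : Triangulation Ω} {k : ℕ} (lam μ : Mh T k) : ℝ :=
  ∑ e : T.faces with OnBoundary Ω e.1, faceIntegral e.1 fun x => (lam e).1 x * (μ e).1 x

open Classical in
/-- `⟨u₀, μ⟩_Γ` -/
def boundaryLoad {T : Triangulation Ω} {k : ℕ} (u₀ : Space d → ℝ) (μ : Mh T k) : ℝ :=
  ∑ e : T.faces with OnBoundary Ω e.1, faceIntegral e.1 fun x => u₀ x * (μ e).1 x

open Classical in
/-- `⟨u₀, q·n⟩_Γ` -/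
def boundaryFluxLoad {T : Triangulation Ω} {k : ℕ} (u₀ : Space d → ℝ) (q : Vh T k) : ℝ :=
  ∑ K : T.elems, ∑ e : T.faces with e.1 ⊆ K.1 ∧ OnBoundary Ω e.1,
    faceIntegral e.1 fun x => u₀ x * normalTrace K.1 e.1 (q K).1 x

/-- The hybridized (Arnold-Brezzi) system for `(q, u, û) ∈ V_h × W_h × M_h`. -/
structure IsHybridSolution (T : Triangulation Ω) (k : ℕ) (κ f u₀ : Space d → ℝ)
    (q : Vh T k) (u : Wh T k) (uhat : Mh T k) : Prop where
  flux : ∀ r : Vh T k, massForm κ q r - divForm u r + traceForm uhat r = 0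
  balance : ∀ w : Wh T k, divForm w q = loadForm f w
  continuity : ∀ μ ∈ MhInterior T k, interiorTraceForm q μ = 0
  dirichlet : ∀ μ ∈ MhBoundary T k, boundaryForm uhat μ = boundaryLoad u₀ μ

/-! ### The space `H(div, Ω)` and the conforming Galerkin equations -/

/-- `g` is the distributional divergence of `q` in `Ω`: `∫_Ω q·∇φ = -∫_Ω g φ` for all
`φ ∈ C_c^∞(Ω)`. -/
def HasWeakDiv (Ω : Set (Space d)) (q : Space d → Space d) (g : Space d → ℝ) : Prop :=
  ∀ φ : Space d → ℝ, ContDiff ℝ ∞ φ → HasCompactSupport φ → tsupport φ ⊆ Ω →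
    ∫ x in Ω, fderiv ℝ φ x (q x) = - ∫ x in Ω, g x * φ x

/-- `q ∈ L²(Ω)^d` and its distributional divergence is in `L²(Ω)`. -/
def MemHdiv (Ω : Set (Space d)) (q : Space d → Space d) : Prop :=
  MemLp q 2 (volume.restrict Ω) ∧
    ∃ g : Space d → ℝ, MemLp g 2 (volume.restrict Ω) ∧ HasWeakDiv Ω q g

open Classical in
/-- The divergence of an element of `H(div, Ω)` (unique up to null sets); zero by convention
for vector fields with no `L²` divergence. -/
def weakDiv (Ω : Set (Space d)) (q : Space d → Space d) : Space d → ℝ :=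
  if h : ∃ g : Space d → ℝ, MemLp g 2 (volume.restrict Ω) ∧ HasWeakDiv Ω q g
  then h.choose else 0

/-- The function on `Ω`, defined up to a null set, that is `u_K` on each (open) element `K`. -/
def scalarFun {T : Triangulation Ω} {k : ℕ} (u : Wh T k) (x : Space d) : ℝ :=
  ∑ K : T.elems, (cell K.1).indicator (fun y => evalAt y (u K).1) x

/-- The vector field on `Ω`, defined up to a null set, that is `q_K` on each (open)
element `K`. -/
def vectorFun {T : Triangulation Ω} {k : ℕ} (q : Vh T k) (x : Space d) : Space d :=
  ∑ K : T.elems, (cell K.1).indicator (fun y => vecEvalAt y (q K).1) x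

/-- `V_h^div = V_h ∩ H(div, Ω)`. -/
def VhDiv (T : Triangulation Ω) (k : ℕ) : Set (Vh T k) :=
  {q | MemHdiv Ω (vectorFun q)}

/-- The conforming Raviart-Thomas Galerkin equations for `(q, u) ∈ V_h^div × W_h`. -/
structure IsGalerkinSolution (T : Triangulation Ω) (k : ℕ) (κ f u₀ : Space d → ℝ)
    (q : Vh T k) (u : Wh T k) : Prop where
  mem : q ∈ VhDiv T k
  flux : ∀ r ∈ VhDiv T k,
    (∫ x in Ω, (κ x)⁻¹ * inner ℝ (vectorFun q x) (vectorFun r x)) -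
      ∫ x in Ω, scalarFun u x * weakDiv Ω (vectorFun r) x = - boundaryFluxLoad u₀ r
  balance : ∀ v : Wh T k,
    ∫ x in Ω, weakDiv Ω (vectorFun q) x * scalarFun v x = ∫ x in Ω, f x * scalarFun v x

end Discrete

end RTHybrid

end

/-!
System (H) is a square linear system, so it suffices that its homogeneous version has only the
trivial solution. There, testing with the unknowns themselves gives `(κ⁻¹ q, q) = 0`, hence `q = 0`.
On an element with vertices `a` and barycentric coordinates `λₐ`, the field `∑ₐ λₐ (∂ₐu) (a - x)`,
where `∂ₐ` is the derivative in the direction `a - x`, has zero normal trace; testing with it shows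
that `u` is constant on the element, and then `û` is the trace of `u` on every face. The field `u x`
is therefore conforming, and testing with it gives `d ‖u‖² = 0`.

For the equivalence of (H) and (G): a piecewise polynomial field lies in `H(div, Ω)` if and only if
its normal jumps on the interior faces vanish, and solvability of (H) makes
`div : V_h^div → W_h` surjective, so that (G) has at most one solution.
-/

namespace RTHybrid

noncomputable section

/-! ### Simplices and barycentric coordinates -/

section Simplex

variable {d : ℕ} {K e s : Finset (Space d)} {x y v : Space d}

theorem isClosed_hull (s : Finset (Space d)) : IsClosed (hull s) :=
  s.finite_toSet.isClosed_convexHull ℝ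

theorem isCompact_hull (s : Finset (Space d)) : IsCompact (hull s) :=
  s.finite_toSet.isCompact_convexHull ℝ

theorem barycenter_eq_centroid (hs : s.Nonempty) : barycenter s = s.centroid ℝ id := by
  rw [Finset.centroid_def, Finset.affineCombination_eq_linear_combination _ _ _
    (s.sum_centroidWeights_eq_one_of_nonempty ℝ hs)]
  simp [barycenter, Finset.smul_sum]

theorem barycenter_mem_hull (hs : s.Nonempty) : barycenter s ∈ hull s := by
  rw [barycenter_eq_centroid hs]
  exact s.centroid_mem_convexHull hs

theorem inner_outwardNormal_of_mem_vectorSpan (hv : v ∈ vectorSpan ℝ (e : Set (Space d))) :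
    inner ℝ v (outwardNormal K e) = 0 := by
  rw [outwardNormal, NormedSpace.normalize, inner_smul_right,
    (Submodule.mem_orthogonal _ _).1 (Submodule.starProjection_apply_mem _ _) v hv, mul_zero]

theorem inner_sub_outwardNormal_of_mem_hull (hx : x ∈ hull e) (hy : y ∈ hull e) :
    inner ℝ (x - y) (outwardNormal K e) = 0 := by
  refine inner_outwardNormal_of_mem_vectorSpan ?_
  rw [← direction_affineSpan]
  exact AffineSubspace.vsub_mem_direction (convexHull_subset_affineSpan _ hx)
    (convexHull_subset_affineSpan _ hy)

/-- `K` is the vertex set of a nondegenerate `d`-simplex in `ℝ^d`. -/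
structure IsSimplex (K : Finset (Space d)) : Prop where
  card_eq : K.card = d + 1
  indep : AffineIndependent ℝ (fun x : K => (x : Space d))

/-- The face of the simplex `K` opposite to the vertex `a`, as a set of vertices. -/
def face (K : Finset (Space d)) (a : K) : Finset (Space d) := K.erase a

theorem mem_face {a : K} : x ∈ face K a ↔ x ≠ a ∧ x ∈ K := Finset.mem_erase

theorem face_subset (a : K) : face K a ⊆ K := Finset.erase_subset _ _

theorem face_injective (K : Finset (Space d)) : Function.Injective (face K) :=
  fun a b h => Subtype.ext (Finset.erase_injOn K a.2 b.2 h)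

/-- The distance of the vertex `a` of the simplex `K` from the hyperplane of the opposite face. -/
def height (K : Finset (Space d)) (a : K) : ℝ :=
  inner ℝ (barycenter (face K a) - a) (outwardNormal K (face K a))

namespace IsSimplex

/-- The vertices of a nondegenerate simplex, as an affine basis of `ℝ^d`. -/
def affineBasis (hK : IsSimplex K) : AffineBasis K ℝ (Space d) where
  toFun := (↑)
  ind' := hK.indep
  tot' := hK.indep.affineSpan_eq_top_iff_card_eq_finrank_add_one.2 (by simp [hK.card_eq])

/-- The barycentric coordinate of the vertex `a` of the simplex `K`. -/
def coord (hK : IsSimplex K) (a : K) : Space d →ᵃ[ℝ] ℝ := hK.affineBasis.coord a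

section Coordinates

variable (hK : IsSimplex K)
include hK

theorem nonempty : K.Nonempty := by
  rw [← Finset.card_pos, hK.card_eq]
  exact d.succ_pos

theorem coord_self (a : K) : hK.coord a a = 1 := hK.affineBasis.coord_apply_eq a

theorem coord_of_ne {a b : K} (h : a ≠ b) : hK.coord a b = 0 := hK.affineBasis.coord_apply_ne h

theorem sum_coord (x : Space d) : ∑ a, hK.coord a x = 1 :=
  hK.affineBasis.sum_coord_apply_eq_one x

theorem sum_coord_smul (x : Space d) : ∑ a, hK.coord a x • (a : Space d) = x :=
  hK.affineBasis.linear_combination_coord_eq_self x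

theorem linear_coord_sub (a : K) (x y : Space d) :
    (hK.coord a).linear (x - y) = hK.coord a x - hK.coord a y :=
  (hK.coord a).linearMap_vsub x y

theorem sum_linear_coord (v : Space d) : ∑ a, (hK.coord a).linear v = 0 := by
  rw [← sub_zero v]
  simp only [hK.linear_coord_sub, Finset.sum_sub_distrib, hK.sum_coord, sub_self]

theorem sum_linear_coord_smul (v : Space d) : ∑ a, (hK.coord a).linear v • (a : Space d) = v := by
  rw [← sub_zero v]
  simp only [hK.linear_coord_sub, sub_smul, Finset.sum_sub_distrib, hK.sum_coord_smul]

theorem coord_barycenter_pos (a : K) : 0 < hK.coord a (barycenter K) := by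
  have h := hK.affineBasis.coord_apply_centroid (Finset.mem_univ a)
  change hK.coord a (Finset.univ.centroid ℝ ((↑) : K → Space d)) = _ at h
  rw [barycenter_eq_centroid hK.nonempty, ← Finset.centroid_univ, h]
  have : 0 < (Finset.univ : Finset K).card := Finset.card_pos.2 ⟨a, Finset.mem_univ a⟩
  positivity

theorem mem_hull_iff : x ∈ hull K ↔ ∀ a, 0 ≤ hK.coord a x := by
  have h := hK.affineBasis.convexHull_eq_nonneg_coord
  rw [show Set.range hK.affineBasis = (K : Set (Space d)) from Subtype.range_coe] at h
  exact Set.ext_iff.1 h x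

theorem mem_cell_iff : x ∈ cell K ↔ ∀ a, 0 < hK.coord a x := by
  have h := hK.affineBasis.interior_convexHull
  rw [show Set.range hK.affineBasis = (K : Set (Space d)) from Subtype.range_coe] at h
  exact Set.ext_iff.1 h x

theorem barycenter_mem_cell : barycenter K ∈ cell K := hK.mem_cell_iff.2 hK.coord_barycenter_pos

theorem coord_le_one (hx : x ∈ hull K) (a : K) : hK.coord a x ≤ 1 :=
  hK.sum_coord x ▸ Finset.single_le_sum (f := (hK.coord · x))
    (fun b _ => hK.mem_hull_iff.1 hx b) (Finset.mem_univ a)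

theorem mem_hull_iff_of_subset (he : e ⊆ K) :
    x ∈ hull e ↔ x ∈ hull K ∧ ∀ a : K, ↑a ∉ e → hK.coord a x = 0 := by
  classical
  constructor
  · refine fun hx => ⟨convexHull_mono (by exact_mod_cast he) hx, fun a ha => ?_⟩
    have hconv : Convex ℝ (hK.coord a ⁻¹' {0}) := (convex_singleton 0).affine_preimage _
    refine convexHull_min (fun b hb => ?_) hconv hx
    exact hK.coord_of_ne (a := a) (b := ⟨b, he hb⟩) fun h => ha (h ▸ hb)
  · rintro ⟨hx, h0⟩
    have hsub {E : Type} [AddCommMonoid E] (F : K → E) (hF : ∀ a : K, ↑a ∉ e → F a = 0) :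
        ∑ a with ↑a ∈ e, F a = ∑ a, F a :=
      Finset.sum_filter_of_ne fun a _ hne => by_contra fun ha => hne (hF a ha)
    rw [← hK.sum_coord_smul x, ← hsub _ fun a ha => by rw [h0 a ha, zero_smul]]
    refine (convex_convexHull ℝ _).sum_mem (fun a _ => hK.mem_hull_iff.1 hx a) ?_ ?_
    · rw [hsub _ h0, hK.sum_coord]
    · exact fun a ha => subset_convexHull ℝ _ (Finset.mem_filter.1 ha).2

theorem mem_hull_face_iff {a : K} : x ∈ hull (face K a) ↔ x ∈ hull K ∧ hK.coord a x = 0 := by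
  rw [hK.mem_hull_iff_of_subset (face_subset a)]
  simp [face]

theorem coord_eq_zero_of_mem_face {a : K} (hx : x ∈ hull (face K a)) : hK.coord a x = 0 :=
  (hK.mem_hull_face_iff.1 hx).2

theorem closure_cell : closure (cell K) = hull K := by
  rw [cell, (convex_convexHull ℝ _).closure_interior_eq_closure_of_nonempty_interior
    ⟨_, hK.barycenter_mem_cell⟩, (isClosed_hull K).closure_eq]

theorem card_face (a : K) : (face K a).card = d := by
  rw [face, Finset.card_erase_of_mem a.2, hK.card_eq, Nat.add_sub_cancel]

theorem exists_face_eq (he : e ⊆ K) (hcard : e.card = d) : ∃ a : K, face K a = e := by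
  have hcov : e ⋖ K := Finset.covBy_iff_card_sdiff_eq_one.2
    ⟨he, by rw [Finset.card_sdiff_of_subset he, hK.card_eq, hcard, Nat.add_sub_cancel_left]⟩
  obtain ⟨a, ha, rfl⟩ := hcov.exists_finset_insert
  exact ⟨⟨a, Finset.mem_insert_self a e⟩, Finset.erase_insert ha⟩

variable [NeZero d]

theorem face_nonempty (a : K) : (face K a).Nonempty := by
  rw [← Finset.card_pos, hK.card_face]
  exact NeZero.pos d

theorem inner_sub_vertex (a : K) (x : Space d) :
    inner ℝ (x - a) (outwardNormal K (face K a)) = height K a * (1 - hK.coord a x) := by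
  have hvertex (b : K) : hK.coord b x * inner ℝ ((b : Space d) - a) (outwardNormal K (face K a)) =
      height K a * (hK.coord b x - if b = a then hK.coord b x else 0) := by
    split_ifs with hb
    · simp [hb]
    · have hbe : (b : Space d) ∈ hull (face K a) :=
        subset_convexHull ℝ _ (mem_face.2 ⟨Subtype.coe_ne_coe.2 hb, b.2⟩)
      have h := inner_sub_outwardNormal_of_mem_hull (K := K) hbe
        (barycenter_mem_hull (hK.face_nonempty a))
      rw [height, sub_zero, mul_comm, ← sub_eq_zero, ← sub_mul, ← inner_sub_left,
        sub_sub_sub_cancel_right, h, zero_mul]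
  have hsum : x - a = ∑ b, hK.coord b x • ((b : Space d) - a) := by
    simp only [smul_sub, Finset.sum_sub_distrib, hK.sum_coord_smul, ← Finset.sum_smul,
      hK.sum_coord, one_smul]
  rw [hsum, sum_inner]
  simp only [real_inner_smul_left, hvertex, ← Finset.mul_sum, Finset.sum_sub_distrib,
    hK.sum_coord, Finset.sum_ite_eq', Finset.mem_univ, if_true]

theorem inner_outwardNormal (a : K) (v : Space d) :
    inner ℝ v (outwardNormal K (face K a)) = -height K a * (hK.coord a).linear v := by
  have h := hK.inner_sub_vertex a (v +ᵥ (a : Space d))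
  rw [AffineMap.map_vadd, hK.coord_self, vadd_eq_add, vadd_eq_add, add_sub_cancel_right] at h
  rw [h]
  ring

theorem inner_barycenter_sub (a : K) :
    inner ℝ (barycenter (face K a) - barycenter K) (outwardNormal K (face K a)) =
      height K a * hK.coord a (barycenter K) := by
  rw [hK.inner_outwardNormal, hK.linear_coord_sub,
    hK.coord_eq_zero_of_mem_face (barycenter_mem_hull (hK.face_nonempty a))]
  ring

theorem starProjection_barycenter_ne_zero (a : K) :
    (vectorSpan ℝ (face K a : Set (Space d)))ᗮ.starProjection
      (barycenter (face K a) - barycenter K) ≠ 0 := by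
  have hker : vectorSpan ℝ (face K a : Set (Space d)) ≤ LinearMap.ker (hK.coord a).linear := by
    refine Submodule.span_le.2 ?_
    rintro _ ⟨b, hb, c, hc, rfl⟩
    have h0 {b : Space d} (hb : b ∈ face K a) : hK.coord a b = 0 :=
      hK.coord_eq_zero_of_mem_face (subset_convexHull ℝ _ hb)
    simp only [vsub_eq_sub, SetLike.mem_coe, LinearMap.mem_ker, hK.linear_coord_sub, h0 hb, h0 hc,
      sub_zero]
  rw [Ne, Submodule.starProjection_apply_eq_zero_iff, Submodule.orthogonal_orthogonal]
  intro h
  have h0 := hker h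
  rw [LinearMap.mem_ker, hK.linear_coord_sub,
    hK.coord_eq_zero_of_mem_face (barycenter_mem_hull (hK.face_nonempty a)), zero_sub,
    neg_eq_zero] at h0
  exact (hK.coord_barycenter_pos a).ne' h0

theorem norm_outwardNormal (a : K) : ‖outwardNormal K (face K a)‖ = 1 :=
  NormedSpace.norm_normalize (hK.starProjection_barycenter_ne_zero a)

theorem height_pos (a : K) : 0 < height K a := by
  refine pos_of_mul_pos_left ?_ (hK.coord_barycenter_pos a).le
  have hw := norm_pos_iff.2 (hK.starProjection_barycenter_ne_zero a)
  rw [← hK.inner_barycenter_sub, outwardNormal, NormedSpace.normalize, inner_smul_right,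
    real_inner_comm]
  have hself := Submodule.re_inner_starProjection_eq_normSq (𝕜 := ℝ)
    (vectorSpan ℝ (face K a : Set (Space d)))ᗮ (barycenter (face K a) - barycenter K)
  rw [RCLike.re_to_real] at hself
  rw [hself]
  exact mul_pos (inv_pos.2 hw) (pow_pos hw 2)

end Coordinates

end IsSimplex

end Simplex

/-! ### Integration over simplices -/

section ConeFormula

open AffineMap (homothety)

variable {d : ℕ} {K : Finset (Space d)} {x y : Space d} {t : ℝ}

theorem continuous_homothety (x : Space d) :
    Continuous fun p : ℝ × Space d => homothety x p.1 p.2 := by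
  simp only [AffineMap.homothety_apply, vsub_eq_sub, vadd_eq_add]
  fun_prop

namespace IsSimplex

variable (hK : IsSimplex K) (a : K)
include hK

theorem coord_homothety_self (t : ℝ) (y : Space d) :
    hK.coord a (homothety (a : Space d) t y) = 1 - t * (1 - hK.coord a y) := by
  rw [AffineMap.homothety_apply, AffineMap.map_vadd, map_smul, vsub_eq_sub, hK.linear_coord_sub,
    hK.coord_self, smul_eq_mul, vadd_eq_add]
  ring

theorem coord_homothety_of_ne {b : K} (hb : b ≠ a) (t : ℝ) (y : Space d) :
    hK.coord b (homothety (a : Space d) t y) = t * hK.coord b y := by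
  rw [AffineMap.homothety_apply, AffineMap.map_vadd, map_smul, vsub_eq_sub, hK.linear_coord_sub,
    hK.coord_of_ne hb, smul_eq_mul, vadd_eq_add, sub_zero, add_zero]

theorem homothety_mem_hull_and_coord_eq_iff (ht : t ∈ Ioc 0 1) :
    homothety (a : Space d) t y ∈ hull K ∧ 1 - hK.coord a (homothety (a : Space d) t y) = t ↔
      y ∈ hull (face K a) := by
  have hcoord : 1 - hK.coord a (homothety (a : Space d) t y) = t ↔ hK.coord a y = 0 := by
    rw [hK.coord_homothety_self, sub_sub_cancel, mul_eq_left₀ ht.1.ne', sub_eq_self]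
  rw [hcoord, hK.mem_hull_face_iff]
  refine and_congr_left fun h0 => ?_
  rw [hK.mem_hull_iff, hK.mem_hull_iff]
  refine forall_congr' fun b => ?_
  rcases eq_or_ne b a with rfl | hb
  · rw [hK.coord_homothety_self, h0]
    simpa using ht.2
  · rw [hK.coord_homothety_of_ne a hb, mul_nonneg_iff_of_pos_left ht.1]

theorem hausdorffMeasure_slice (ht : t ∈ Ioc 0 1) (B : Set (Space d)) :
    μHE[d - 1] (hull K ∩ B ∩ {x | 1 - hK.coord a x = t}) =
      ENNReal.ofReal (t ^ (d - 1)) *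
        μHE[d - 1] (homothety (a : Space d) t ⁻¹' B ∩ hull (face K a)) := by
  have hpre : homothety (a : Space d) t ⁻¹' (hull K ∩ B ∩ {x | 1 - hK.coord a x = t}) =
      homothety (a : Space d) t ⁻¹' B ∩ hull (face K a) := by
    ext y
    rw [mem_inter_iff (b := hull _), ← hK.homothety_mem_hull_and_coord_eq_iff a ht]
    simp only [mem_preimage, mem_inter_iff, mem_ofPred_eq]
    tauto
  have hsurj : Function.Surjective (homothety (a : Space d) t) := fun x =>
    ⟨homothety (a : Space d) t⁻¹ x, by
      rw [← AffineMap.homothety_mul_apply, mul_inv_cancel₀ ht.1.ne', AffineMap.homothety_one,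
        AffineMap.id_apply]⟩
  rw [← image_preimage_eq (hull K ∩ B ∩ _) hsurj, hpre,
    euclideanHausdorffMeasure_homothety_image _ _ ht.1.ne', ENNReal.smul_def, smul_eq_mul,
    ENNReal.coe_pow, ENNReal.ofReal_pow ht.1.le, ← Real.enorm_eq_ofReal ht.1.le]
  rfl

variable [NeZero d]

theorem mem_slice_iff (x : Space d) (t : ℝ) :
    x ∈ AffineSubspace.mk' (t • (height K a • outwardNormal K (face K a)) +ᵥ (a : Space d))
      (ℝ ∙ (height K a • outwardNormal K (face K a)))ᗮ ↔ 1 - hK.coord a x = t := by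
  have hn : inner ℝ (outwardNormal K (face K a)) (outwardNormal K (face K a)) = 1 := by
    rw [real_inner_self_eq_norm_sq, hK.norm_outwardNormal, one_pow]
  rw [AffineSubspace.mem_mk', Submodule.mem_orthogonal_singleton_iff_inner_left,
    vsub_vadd_eq_vsub_sub, vsub_eq_sub, inner_sub_left]
  simp only [real_inner_smul_left, real_inner_smul_right, hK.inner_sub_vertex, hn, mul_one]
  rw [← mul_sub, mul_comm t, ← mul_sub, mul_eq_zero_iff_left (hK.height_pos a).ne',
    mul_eq_zero_iff_left (hK.height_pos a).ne', sub_eq_zero]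

theorem volume_hull_inter {B : Set (Space d)} (hB : MeasurableSet B) :
    volume (hull K ∩ B) = ENNReal.ofReal (height K a) *
      ∫⁻ t in Ioc (0 : ℝ) 1, ENNReal.ofReal (t ^ (d - 1)) *
        μHE[d - 1] (homothety (a : Space d) t ⁻¹' B ∩ hull (face K a)) := by
  have hpos := hK.height_pos a
  have hv : height K a • outwardNormal K (face K a) ≠ 0 :=
    smul_ne_zero hpos.ne' (norm_ne_zero_iff.1 (hK.norm_outwardNormal a ▸ one_ne_zero))
  have hslice := EuclideanGeometry.euclideanHausdorffMeasure_eq_lintegral (a : Space d) hv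
    ((isClosed_hull K).measurableSet.inter hB)
  rw [InnerProductSpace.euclideanHausdorffMeasure_eq_volume, finrank_euclideanSpace_fin,
    enorm_smul, Real.enorm_eq_ofReal hpos.le, ← ofReal_norm, hK.norm_outwardNormal,
    ENNReal.ofReal_one, mul_one] at hslice
  rw [hslice, ← lintegral_indicator measurableSet_Ioc]
  congr 1
  refine lintegral_congr_ae ?_
  filter_upwards [Measure.ae_ne volume (0 : ℝ)] with t ht0
  have hset : (AffineSubspace.mk' (t • (height K a • outwardNormal K (face K a)) +ᵥ (a : Space d))
      (ℝ ∙ (height K a • outwardNormal K (face K a)))ᗮ : Set (Space d)) =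
      {x | 1 - hK.coord a x = t} := Set.ext fun x => hK.mem_slice_iff a x t
  rw [hset]
  by_cases ht : t ∈ Ioc 0 1
  · rw [indicator_of_mem ht, hK.hausdorffMeasure_slice a ht]
  · rw [indicator_of_notMem ht]
    suffices h : hull K ∩ B ∩ {x | 1 - hK.coord a x = t} = ∅ by rw [h, measure_empty]
    refine eq_empty_of_forall_notMem ?_
    rintro x ⟨⟨hx, -⟩, rfl⟩
    have h0 := hK.mem_hull_iff.1 hx a
    have h1 := hK.coord_le_one hx a
    exact ht ⟨lt_of_le_of_ne (sub_nonneg.2 h1) ht0.symm, by linarith⟩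

theorem hausdorffMeasure_face_lt_top : μHE[d - 1] (hull (face K a)) < ⊤ := by
  have h := hK.volume_hull_inter a MeasurableSet.univ
  simp only [inter_univ, preimage_univ, univ_inter] at h
  have hradial : 0 < ∫⁻ t in Ioc (0 : ℝ) 1, ENNReal.ofReal (t ^ (d - 1)) := by
    have hsupp : Ioc (0 : ℝ) 1 ⊆ Function.support fun t => ENNReal.ofReal (t ^ (d - 1)) :=
      fun t ht => (ENNReal.ofReal_pos.2 (pow_pos ht.1 _)).ne'
    rw [setLIntegral_pos_iff (by fun_prop), inter_eq_self_of_subset_right hsupp]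
    simp
  rw [lintegral_mul_const _ (by fun_prop)] at h
  by_contra htop
  rw [not_lt_top_iff.1 htop, ENNReal.mul_top hradial.ne',
    ENNReal.mul_top (ENNReal.ofReal_pos.2 (hK.height_pos a)).ne'] at h
  exact (isCompact_hull K).measure_ne_top h

theorem isFiniteMeasure_face : IsFiniteMeasure (μHE[d - 1].restrict (hull (face K a))) :=
  isFiniteMeasure_restrict.2 (hK.hausdorffMeasure_face_lt_top a).ne

theorem volume_restrict_hull :
    volume.restrict (hull K) = ENNReal.ofReal (height K a) •
      Measure.map (fun p : ℝ × Space d => homothety (a : Space d) p.1 p.2)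
        (((volume.restrict (Ioc (0 : ℝ) 1)).withDensity fun t => ENNReal.ofReal (t ^ (d - 1))).prod
          (μHE[d - 1].restrict (hull (face K a)))) := by
  have := hK.isFiniteMeasure_face a
  have hcont := continuous_homothety (a : Space d)
  ext B hB
  have hpre := hcont.measurable hB
  have hslice (t : ℝ) : MeasurableSet (homothety (a : Space d) t ⁻¹' B) :=
    measurable_prodMk_left hpre
  rw [Measure.restrict_apply hB, inter_comm, hK.volume_hull_inter a hB, Measure.smul_apply,
    Measure.map_apply hcont.measurable hB, Measure.prod_apply hpre,
    lintegral_withDensity_eq_lintegral_mul _ (by fun_prop) (measurable_measure_prodMk_left hpre)]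
  simp only [Pi.mul_apply, smul_eq_mul]
  congr! 4
  exact (Measure.restrict_apply (hslice _)).symm

theorem integrableOn_face {g : Space d → ℝ} (hg : Continuous g) :
    IntegrableOn g (hull (face K a)) μHE[d - 1] :=
  hg.continuousOn.integrableOn_of_subset_isCompact (isCompact_hull _)
    (isClosed_hull _).measurableSet Subset.rfl (hK.hausdorffMeasure_face_lt_top a).ne

/-- The point where the line through the vertex `a` and `x` meets the hyperplane of the opposite
face; `a` itself if the line is parallel to this hyperplane. -/
def coneProj (x : Space d) : Space d := homothety (a : Space d) (1 - hK.coord a x)⁻¹ x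

omit [NeZero d] in
theorem measurable_coneProj : Measurable (hK.coneProj a) := by
  have hcoord : Continuous (hK.coord a) := (hK.coord a).continuous_of_finiteDimensional
  exact (continuous_homothety (a : Space d)).measurable.comp
    ((measurable_const.sub hcoord.measurable).inv.prodMk measurable_id)

omit [NeZero d] in
theorem coneProj_homothety (ht : t ≠ 0) (hy : y ∈ hull (face K a)) :
    hK.coneProj a (homothety (a : Space d) t y) = y := by
  rw [coneProj, hK.coord_homothety_self, hK.coord_eq_zero_of_mem_face hy, sub_zero, mul_one,
    sub_sub_cancel, ← AffineMap.homothety_mul_apply, inv_mul_cancel₀ ht, AffineMap.homothety_one,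
    AffineMap.id_apply]

omit [NeZero d] in
theorem coneProj_eq_self (hy : y ∈ hull (face K a)) : hK.coneProj a y = y := by
  simpa using hK.coneProj_homothety a one_ne_zero hy

omit [NeZero d] in
theorem continuousAt_coneProj (hy : y ∈ hull (face K a)) : ContinuousAt (hK.coneProj a) y := by
  have hcoord : Continuous (hK.coord a) := (hK.coord a).continuous_of_finiteDimensional
  have hne : 1 - hK.coord a y ≠ 0 := by simp [hK.coord_eq_zero_of_mem_face hy]
  exact (continuous_homothety (a : Space d)).continuousAt.comp
    (f := fun x => ((1 - hK.coord a x)⁻¹, x))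
    (((continuous_const.sub hcoord).continuousAt.inv₀ hne).prodMk continuousAt_id)

/-- Otherwise the cone over the set `{g ≠ 0}` would be a null neighbourhood of a point of
`hull K`. -/
theorem eq_zero_of_integral_face_eq_zero {g : Space d → ℝ} (hg : Continuous g)
    (h0 : ∀ y ∈ hull (face K a), 0 ≤ g y) (hzero : ∫ y in hull (face K a), g y ∂μHE[d - 1] = 0)
    (hy : y ∈ hull (face K a)) : g y = 0 := by
  by_contra hgy
  let B : Set (Space d) := {x | g (hK.coneProj a x) ≠ 0}
  have hae : ∀ᵐ z ∂μHE[d - 1].restrict (hull (face K a)), g z = 0 :=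
    (setIntegral_eq_zero_iff_of_nonneg_ae
      ((ae_restrict_mem (isClosed_hull _).measurableSet).mono h0)
      (hK.integrableOn_face a hg)).1 hzero
  rw [ae_restrict_iff' (isClosed_hull _).measurableSet] at hae
  have hBmeas : MeasurableSet B :=
    (hg.measurable.comp (hK.measurable_coneProj a)) (measurableSet_singleton 0).compl
  have hnull : volume (hull K ∩ B) = 0 := by
    rw [hK.volume_hull_inter a hBmeas]
    refine mul_eq_zero_of_right _ (setLIntegral_eq_zero measurableSet_Ioc fun t ht => ?_)
    refine mul_eq_zero_of_right _ (measure_mono_null (fun z hz => ?_) (ae_iff.1 hae))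
    have hzB : g (hK.coneProj a (homothety (a : Space d) t z)) ≠ 0 := hz.1
    rw [hK.coneProj_homothety a ht.1.ne' hz.2] at hzB
    exact fun h => hzB (h hz.2)
  have hB : B ∈ nhds y :=
    (hg.continuousAt.comp (hK.continuousAt_coneProj a hy)).eventually_ne
      (by rwa [Function.comp_apply, hK.coneProj_eq_self a hy])
  have hclosure : y ∈ closure (cell K) := hK.closure_cell ▸ (hK.mem_hull_face_iff.1 hy).1
  obtain ⟨U, hUB, hU, hyU⟩ := mem_nhds_iff.1 hB
  have hpos := (hU.inter isOpen_interior).measure_pos volume (mem_closure_iff.1 hclosure U hU hyU)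
  have hsub : U ∩ cell K ⊆ hull K ∩ B := fun x hx => ⟨interior_subset hx.2, hUB hx.1⟩
  exact hpos.ne' (measure_mono_null hsub hnull)

theorem integral_hull_eq {G : Space d → ℝ} (hG : Continuous G) :
    ∫ x in hull K, G x = height K a * ∫ y in hull (face K a),
      (∫ t in (0 : ℝ)..1, t ^ (d - 1) * G (homothety (a : Space d) t y)) ∂μHE[d - 1] := by
  have hcont := continuous_homothety (a : Space d)
  have := hK.isFiniteMeasure_face a
  have hpos := hK.height_pos a
  have hgi : IntegrableOn G (hull K) := hG.continuousOn.integrableOn_compact (isCompact_hull K)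
  rw [IntegrableOn, hK.volume_restrict_hull a,
    integrable_smul_measure (ENNReal.ofReal_pos.2 hpos).ne' ENNReal.ofReal_ne_top,
    integrable_map_measure hG.aestronglyMeasurable hcont.aemeasurable] at hgi
  rw [hK.volume_restrict_hull a, integral_smul_measure, ENNReal.toReal_ofReal hpos.le,
    integral_map hcont.aemeasurable hG.aestronglyMeasurable]
  refine (congrArg (height K a * ·) (integral_prod_symm _ hgi)).trans ?_
  congr 1
  refine integral_congr_ae (.of_forall fun y => ?_)
  simp only
  rw [integral_withDensity_eq_integral_toReal_smul (by fun_prop)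
    (.of_forall fun t => ENNReal.ofReal_lt_top), intervalIntegral.integral_of_le zero_le_one]
  refine setIntegral_congr_fun measurableSet_Ioc fun t ht => ?_
  simp only [ENNReal.toReal_ofReal (pow_nonneg ht.1.le (d - 1)), smul_eq_mul, Function.comp_apply]

theorem integral_radial {F : Space d → ℝ} (hF : ContDiff ℝ 1 F) :
    ∫ x in hull K, (d * F x + fderiv ℝ F x (x - a)) =
      height K a * ∫ y in hull (face K a), F y ∂μHE[d - 1] := by
  have := hF.continuous_fderiv one_ne_zero
  have := hF.continuous
  rw [hK.integral_hull_eq a (by fun_prop)]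
  congr 2 with y
  have hderiv (t : ℝ) : HasDerivAt (fun s : ℝ => s ^ d * F (homothety (a : Space d) s y))
      (t ^ (d - 1) * (d * F (homothety (a : Space d) t y) +
        fderiv ℝ F (homothety (a : Space d) t y) (homothety (a : Space d) t y - a))) t := by
    have hline : HasDerivAt (fun s : ℝ => homothety (a : Space d) s y) (y - a) t := by
      simp only [AffineMap.homothety_apply, vsub_eq_sub, vadd_eq_add]
      simpa using ((hasDerivAt_id t).smul_const (y - (a : Space d))).add_const (a : Space d)
    have hcomp := (hasDerivAt_pow d t).mul
      (((hF.differentiable one_ne_zero) _).hasFDerivAt.comp_hasDerivAt t hline)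
    refine hcomp.congr_deriv ?_
    have hpow : t ^ d = t ^ (d - 1) * t := (pow_sub_one_mul (NeZero.ne d) t).symm
    simp only [Function.comp_apply, AffineMap.homothety_apply, vsub_eq_sub, vadd_eq_add,
      add_sub_cancel_right, map_smul, smul_eq_mul, hpow]
    ring
  rw [intervalIntegral.integral_eq_sub_of_hasDerivAt fun t _ => hderiv t]
  · simp [NeZero.ne d]
  · have hcurve : Continuous fun t : ℝ => homothety (a : Space d) t y :=
      (continuous_homothety (a : Space d)).comp (continuous_id.prodMk continuous_const)
    have hcont : Continuous fun t : ℝ => t ^ (d - 1) * (d * F (homothety (a : Space d) t y) +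
        fderiv ℝ F (homothety (a : Space d) t y) (homothety (a : Space d) t y - a)) := by
      fun_prop
    exact hcont.intervalIntegrable _ _

theorem integral_fderiv_apply {F : Space d → ℝ} (hF : ContDiff ℝ 1 F) (v : Space d) :
    ∫ x in hull K, fderiv ℝ F x v =
      ∑ a, inner ℝ v (outwardNormal K (face K a)) * ∫ y in hull (face K a), F y ∂μHE[d - 1] := by
  have hweights (x : Space d) :
      ∑ a, (hK.coord a).linear v * (d * F x + fderiv ℝ F x (x - a)) = -fderiv ℝ F x v := by
    have hv : fderiv ℝ F x v = ∑ a, (hK.coord a).linear v * fderiv ℝ F x a := by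
      conv_lhs => rw [← hK.sum_linear_coord_smul v, map_sum]
      simp only [map_smul, smul_eq_mul]
    rw [hv]
    simp only [map_sub, mul_add, mul_sub, Finset.sum_add_distrib, Finset.sum_sub_distrib,
      ← Finset.sum_mul, hK.sum_linear_coord]
    ring
  calc ∫ x in hull K, fderiv ℝ F x v
      = -∑ a, (hK.coord a).linear v * ∫ x in hull K, (d * F x + fderiv ℝ F x (x - a)) := by
        simp only [← integral_const_mul]
        rw [← integral_finsetSum, ← integral_neg]
        · simp only [hweights, neg_neg]
        · intro a _
          have := hF.continuous_fderiv one_ne_zero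
          have := hF.continuous
          have hcont : Continuous fun x =>
              (hK.coord a).linear v * (d * F x + fderiv ℝ F x (x - a)) := by fun_prop
          exact hcont.continuousOn.integrableOn_compact (isCompact_hull K)
    _ = _ := by
        rw [← Finset.sum_neg_distrib]
        refine Finset.sum_congr rfl fun a _ => ?_
        rw [hK.integral_radial a hF, hK.inner_outwardNormal]
        ring

end IsSimplex

end ConeFormula

/-! ### Polynomial spaces -/

section Polynomials

variable {d k : ℕ} {K e : Finset (Space d)} {x : Space d} {p q : Poly d}

@[simp]
theorem evalAt_mul (x : Space d) (p q : Poly d) : evalAt x (p * q) = evalAt x p * evalAt x q :=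
  map_mul (MvPolynomial.aeval _) p q

@[simp]
theorem evalAt_C (x : Space d) (c : ℝ) : evalAt x (MvPolynomial.C c) = c :=
  MvPolynomial.aeval_C _ c

@[simp]
theorem evalAt_X (x : Space d) (i : Fin d) : evalAt x (MvPolynomial.X i) = x i :=
  MvPolynomial.aeval_X _ i

theorem analyticOnNhd_evalAt (p : Poly d) : AnalyticOnNhd ℝ (fun x => evalAt x p) univ := by
  have hcoord (i : Fin d) : AnalyticOnNhd ℝ (fun x : Space d => x i) univ := fun x _ =>
    (EuclideanSpace.proj i : Space d →L[ℝ] ℝ).analyticAt x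
  exact AnalyticOnNhd.aeval_mvPolynomial hcoord p

theorem contDiff_evalAt (p : Poly d) : ContDiff ℝ ∞ fun x => evalAt x p :=
  (analyticOnNhd_evalAt p).contDiff

@[fun_prop]
theorem continuous_evalAt (p : Poly d) : Continuous fun x => evalAt x p :=
  (contDiff_evalAt p).continuous

theorem differentiable_evalAt (p : Poly d) : Differentiable ℝ fun x => evalAt x p :=
  (contDiff_evalAt p).differentiable (by simp)

/-- The derivative of a polynomial in the direction `v`. -/
def dirDeriv (v : Space d) (p : Poly d) : Poly d := ∑ i, v i • MvPolynomial.pderiv i p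

theorem fderiv_evalAt (p : Poly d) (x v : Space d) :
    fderiv ℝ (fun y => evalAt y p) x v = evalAt x (dirDeriv v p) := by
  induction p using MvPolynomial.induction_on with
  | C c => simp [dirDeriv]
  | add p q hp hq =>
    simp only [dirDeriv, map_add, smul_add, Finset.sum_add_distrib] at hp hq ⊢
    rw [← hp, ← hq, fderiv_fun_add (differentiable_evalAt p x) (differentiable_evalAt q x),
      add_apply]
  | mul_X p i hp =>
    have hX : HasFDerivAt (fun y : Space d => y i) (EuclideanSpace.proj i : Space d →L[ℝ] ℝ) x :=
      (EuclideanSpace.proj i : Space d →L[ℝ] ℝ).hasFDerivAt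
    have hleibniz : dirDeriv v (p * MvPolynomial.X i) =
        v i • p + MvPolynomial.X i * dirDeriv v p := by
      simp only [dirDeriv, MvPolynomial.pderiv_mul, MvPolynomial.pderiv_X, smul_add,
        Finset.sum_add_distrib, Finset.mul_sum, mul_smul_comm]
      rw [add_comm, Finset.sum_eq_single i (fun j _ hj => by simp [hj.symm]) (by simp)]
      simp [mul_comm]
    simp only [evalAt_mul, evalAt_X]
    rw [((differentiable_evalAt p x).hasFDerivAt.fun_mul hX).fderiv, hleibniz]
    simp [hp, mul_comm]

theorem eq_zero_of_evalAt_eq_zero {U : Set (Space d)} (hU : IsOpen U) (hne : U.Nonempty)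
    (h : ∀ x ∈ U, evalAt x p = 0) : p = 0 := by
  obtain ⟨x, hx⟩ := hne
  have hzero : (fun x => evalAt x p) = 0 :=
    (analyticOnNhd_evalAt p).eq_of_eventuallyEq analyticOnNhd_const
      (Filter.mem_of_superset (hU.mem_nhds hx) h)
  exact MvPolynomial.funext fun y => congrFun hzero (WithLp.toLp 2 y)

theorem mem_Pk : p ∈ Pk d k ↔ p.totalDegree ≤ k := MvPolynomial.mem_restrictTotalDegree _ _ _

theorem Pk_le_iff {E : Submodule ℝ (Poly d)} :
    Pk d k ≤ E ↔ ∀ m : Fin d →₀ ℕ, m.degree ≤ k → MvPolynomial.monomial m 1 ∈ E := by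
  rw [Pk, MvPolynomial.restrictTotalDegree, MvPolynomial.restrictSupport_eq_span,
    Submodule.span_le, image_subset_iff]
  rfl

theorem mul_pderiv_mem_Pk (hp : p ∈ Pk d k) (hq : q.totalDegree ≤ 1) (i : Fin d) :
    q * MvPolynomial.pderiv i p ∈ Pk d k := by
  suffices h : Pk d k ≤ (Pk d k).comap
      (LinearMap.mulLeft ℝ q ∘ₗ (MvPolynomial.pderiv i).toLinearMap) from h hp
  refine Pk_le_iff.2 fun m hm => ?_
  change q * MvPolynomial.pderiv i (MvPolynomial.monomial m 1) ∈ Pk d k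
  rw [MvPolynomial.pderiv_monomial]
  rcases eq_or_ne (m i) 0 with hi | hi
  · simp [hi]
  · set m' := m - Finsupp.single i 1
    have hm' : m' + Finsupp.single i 1 = m :=
      tsub_add_cancel_of_le (Finsupp.single_le_iff.2 (Nat.one_le_iff_ne_zero.2 hi))
    have hdeg : m'.degree + 1 = m.degree := by simp [← hm']
    have hmul := MvPolynomial.totalDegree_mul q (MvPolynomial.monomial m' ((1 : ℝ) * m i))
    have hmon : (MvPolynomial.monomial m' ((1 : ℝ) * m i)).totalDegree ≤ m'.degree :=
      MvPolynomial.totalDegree_monomial_le _ _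
    exact mem_Pk.2 (by omega)

theorem mul_dirDeriv_mem_Pk (hp : p ∈ Pk d k) (hq : q.totalDegree ≤ 1) (v : Space d) :
    q * dirDeriv v p ∈ Pk d k := by
  rw [dirDeriv, Finset.mul_sum]
  exact sum_mem fun i _ => by
    rw [mul_smul_comm]
    exact Submodule.smul_mem _ _ (mul_pderiv_mem_Pk hp hq i)

theorem mulPosition_mem_RT (hp : p ∈ Pk d k) : mulPosition d p ∈ RT d k := by
  suffices h : Pk d k ≤ (RT d k).comap (mulPosition d) from h hp
  refine Pk_le_iff.2 fun m hm => ?_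
  rcases hm.eq_or_lt with rfl | hlt
  · exact Submodule.mem_sup_right (Submodule.mem_map_of_mem
      (MvPolynomial.isHomogeneous_monomial 1 rfl))
  · refine Submodule.mem_sup_left fun i _ => mem_Pk.2 ?_
    have hmul := MvPolynomial.totalDegree_mul (MvPolynomial.X i) (MvPolynomial.monomial m (1 : ℝ))
    have hmon : (MvPolynomial.monomial m (1 : ℝ)).totalDegree ≤ m.degree :=
      MvPolynomial.totalDegree_monomial_le _ _
    rw [MvPolynomial.totalDegree_X] at hmul
    simp only [mulPosition, LinearMap.pi_apply, LinearMap.mulLeft_apply]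
    omega

/-- The vector field `p (x - a)`. -/
def radialField (p : Poly d) (a : Space d) : Fin d → Poly d :=
  mulPosition d p - fun i => a i • p

theorem radialField_mem_RT (hp : p ∈ Pk d k) (a : Space d) : radialField p a ∈ RT d k :=
  sub_mem (mulPosition_mem_RT hp)
    (Submodule.mem_sup_left fun i _ => Submodule.smul_mem _ (a i) hp)

theorem vecEvalAt_radialField (p : Poly d) (a x : Space d) :
    vecEvalAt x (radialField p a) = evalAt x p • (x - a) := by
  ext i
  simp only [vecEvalAt, radialField, mulPosition, Pi.sub_apply, LinearMap.pi_apply,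
    LinearMap.mulLeft_apply, map_sub, evalAt_mul, evalAt_X, map_smul, smul_eq_mul, PiLp.smul_apply,
    PiLp.sub_apply]
  ring

theorem inner_vecEvalAt (q : Fin d → Poly d) (x v : Space d) :
    inner ℝ (vecEvalAt x q) v = ∑ i, v i * evalAt x (q i) := by
  simp [PiLp.inner_apply, vecEvalAt]

@[fun_prop]
theorem continuous_vecEvalAt (q : Fin d → Poly d) : Continuous fun x => vecEvalAt x q :=
  (PiLp.continuous_toLp 2 _).comp (continuous_pi fun i => continuous_evalAt (q i))

@[fun_prop]
theorem continuous_normalTrace (K e : Finset (Space d)) (q : Fin d → Poly d) :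
    Continuous (normalTrace K e q) :=
  (continuous_vecEvalAt q).inner continuous_const

/-- The trace on a face of `RT_k` lands in `P_k`, because `x · n` is constant on the face. -/
theorem exists_evalAt_eq_normalTrace {q : Fin d → Poly d} (hq : q ∈ RT d k) (he : e.Nonempty) :
    ∃ p ∈ Pk d k, ∀ x ∈ hull e, evalAt x p = normalTrace K e q x := by
  obtain ⟨b, hb⟩ := he
  obtain ⟨s, hs, _, ⟨g, hg, rfl⟩, rfl⟩ := Submodule.mem_sup.1 hq
  set n := outwardNormal K e with hn
  refine ⟨∑ i, n i • s i + inner ℝ b n • g, ?_, fun x hx => ?_⟩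
  · refine add_mem (sum_mem fun i _ => Submodule.smul_mem _ _ (hs i trivial))
      (Submodule.smul_mem _ _ (mem_Pk.2 ?_))
    exact ((MvPolynomial.mem_homogeneousSubmodule _ _).1 hg).totalDegree_le
  · have hconst : inner ℝ x n = inner ℝ b n := by
      rw [← sub_eq_zero, ← inner_sub_left]
      exact inner_sub_outwardNormal_of_mem_hull hx (subset_convexHull ℝ _ hb)
    rw [normalTrace, inner_vecEvalAt, ← hn, ← hconst, PiLp.inner_apply]
    simp only [mulPosition, Pi.add_apply, LinearMap.pi_apply, LinearMap.mulLeft_apply, map_add,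
      map_sum, map_smul, evalAt_mul, evalAt_X, mul_add, Finset.sum_add_distrib, Finset.sum_mul,
      smul_eq_mul, RCLike.inner_apply, conj_trivial, mul_assoc]

/-- An affine function as a polynomial. -/
def affinePoly (L : Space d →ᵃ[ℝ] ℝ) : Poly d :=
  MvPolynomial.C (L 0) +
    ∑ i, MvPolynomial.C (L.linear (EuclideanSpace.single i 1)) * MvPolynomial.X i

theorem evalAt_affinePoly (L : Space d →ᵃ[ℝ] ℝ) (x : Space d) : evalAt x (affinePoly L) = L x := by
  have hx : x = ∑ i, x i • EuclideanSpace.single i (1 : ℝ) := by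
    ext j
    simp [Pi.single_apply]
  have hL : L x = L.linear x + L 0 := by
    rw [← vadd_eq_add, ← L.map_vadd, vadd_eq_add, add_zero]
  rw [hL]
  conv_rhs => rw [hx, map_sum]
  simp [affinePoly, mul_comm, add_comm]

theorem totalDegree_affinePoly_le (L : Space d →ᵃ[ℝ] ℝ) : (affinePoly L).totalDegree ≤ 1 := by
  refine (MvPolynomial.totalDegree_add _ _).trans (max_le (by simp) ?_)
  refine MvPolynomial.totalDegree_finsetSum_le fun i _ =>
    (MvPolynomial.totalDegree_mul _ _).trans ?_
  simp

/-- The Leibniz rule `div (φ q) = q · ∇φ + φ div q`, with the left side written out. -/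
theorem sum_fderiv_mul_evalAt {φ : Space d → ℝ} (hφ : Differentiable ℝ φ) (q : Fin d → Poly d)
    (x : Space d) :
    ∑ i, fderiv ℝ (fun y => φ y * evalAt y (q i)) x (EuclideanSpace.single i 1) =
      fderiv ℝ φ x (vecEvalAt x q) + φ x * evalAt x (polyDiv q) := by
  have hq : vecEvalAt x q = ∑ i, evalAt x (q i) • EuclideanSpace.single i (1 : ℝ) := by
    ext j
    simp [vecEvalAt, Pi.single_apply]
  have hsingle (i : Fin d) : dirDeriv (EuclideanSpace.single i 1) (q i) =
      MvPolynomial.pderiv i (q i) := by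
    rw [dirDeriv, Finset.sum_eq_single i (fun j _ hj => by simp [hj]) (by simp)]
    simp
  rw [hq, polyDiv]
  simp only [map_sum, map_smul, smul_eq_mul, Finset.mul_sum, ← Finset.sum_add_distrib]
  refine Finset.sum_congr rfl fun i _ => ?_
  rw [((hφ x).hasFDerivAt.fun_mul (differentiable_evalAt (q i) x).hasFDerivAt).fderiv]
  simp [fderiv_evalAt, hsingle, add_comm]

theorem IsSimplex.integral_div [NeZero d] (hK : IsSimplex K) {φ : Space d → ℝ}
    (hφ : ContDiff ℝ 1 φ) (q : Fin d → Poly d) :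
    ∫ x in hull K, (fderiv ℝ φ x (vecEvalAt x q) + φ x * evalAt x (polyDiv q)) =
      ∑ a, ∫ x in hull (face K a), φ x * normalTrace K (face K a) q x ∂μHE[d - 1] := by
  have hF (i : Fin d) : ContDiff ℝ 1 fun x => φ x * evalAt x (q i) :=
    hφ.mul ((contDiff_evalAt (q i)).of_le (by norm_cast))
  simp only [← sum_fderiv_mul_evalAt (hφ.differentiable one_ne_zero)]
  rw [integral_finsetSum _ fun i _ => (((hF i).continuous_fderiv one_ne_zero).clm_apply
    continuous_const).continuousOn.integrableOn_compact (isCompact_hull K)]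
  simp only [hK.integral_fderiv_apply (hF _)]
  rw [Finset.sum_comm]
  refine Finset.sum_congr rfl fun a _ => ?_
  simp only [← integral_const_mul]
  rw [← integral_finsetSum]
  · refine integral_congr_ae (.of_forall fun x => ?_)
    simp only [normalTrace, inner_vecEvalAt, Finset.mul_sum, EuclideanSpace.inner_single_left,
      map_one, one_mul, mul_left_comm]
  · exact fun i _ => hK.integrableOn_face a (continuous_const.mul (hF i).continuous)

end Polynomials

/-! ### Meshes -/

section FaceInterior

variable {d : ℕ} {K : Finset (Space d)} {x y z : Space d}

namespace IsSimplex

variable (hK : IsSimplex K) (a : K)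

/-- The relative interior of the face opposite to the vertex `a`. -/
def faceInterior : Set (Space d) := {x | hK.coord a x = 0 ∧ ∀ b ≠ a, 0 < hK.coord b x}

theorem faceInterior_subset : hK.faceInterior a ⊆ hull (face K a) := by
  refine fun x hx => hK.mem_hull_face_iff.2 ⟨hK.mem_hull_iff.2 fun b => ?_, hx.1⟩
  rcases eq_or_ne b a with rfl | hb
  exacts [hx.1.ge, (hx.2 b hb).le]

theorem eventually_lineMap_mem_faceInterior (hx : x ∈ hK.faceInterior a)
    (hy : y ∈ hull (face K a)) :
    ∀ᶠ t in nhds (0 : ℝ), AffineMap.lineMap x y t ∈ hK.faceInterior a := by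
  have hcoord (b : K) (t : ℝ) : hK.coord b (AffineMap.lineMap (k := ℝ) x y t) =
      (1 - t) * hK.coord b x + t * hK.coord b y := by
    rw [AffineMap.apply_lineMap, AffineMap.lineMap_apply_module, smul_eq_mul, smul_eq_mul]
  have hpos : ∀ᶠ t in nhds (0 : ℝ), ∀ b ≠ a, 0 < hK.coord b (AffineMap.lineMap (k := ℝ) x y t) := by
    refine Filter.eventually_all.2 fun b => Filter.eventually_imp_distrib_left.2 fun hb => ?_
    have hc : Continuous fun t => hK.coord b (AffineMap.lineMap (k := ℝ) x y t) := by
      simp only [hcoord]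
      fun_prop
    exact hc.continuousAt.eventually_const_lt (by simpa using hx.2 b hb)
  refine hpos.mono fun t ht => ⟨?_, ht⟩
  rw [hcoord, hx.1, hK.coord_eq_zero_of_mem_face hy, mul_zero, mul_zero, add_zero]

variable [NeZero d]

include hK in
theorem coord_lt_one (hx : x ∈ cell K) : hK.coord a x < 1 := by
  obtain ⟨b, hb⟩ := hK.face_nonempty a
  rw [mem_face] at hb
  rw [← hK.sum_coord x]
  exact Finset.single_lt_sum (f := (hK.coord · x)) (j := ⟨b, hb.2⟩)
    (fun h => hb.1 (congrArg Subtype.val h)) (Finset.mem_univ a) (Finset.mem_univ _)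
    (hK.mem_cell_iff.1 hx _) fun c _ _ => (hK.mem_cell_iff.1 hx c).le

theorem coneProj_mem_faceInterior (hx : x ∈ cell K) : hK.coneProj a x ∈ hK.faceInterior a := by
  have hpos : 0 < 1 - hK.coord a x := sub_pos.2 (hK.coord_lt_one a hx)
  refine ⟨?_, fun b hb => ?_⟩
  · rw [coneProj, hK.coord_homothety_self, inv_mul_cancel₀ hpos.ne', sub_self]
  · rw [coneProj, hK.coord_homothety_of_ne a hb]
    exact mul_pos (inv_pos.2 hpos) (hK.mem_cell_iff.1 hx b)

theorem hull_face_subset_closure_faceInterior :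
    hull (face K a) ⊆ closure (hK.faceInterior a) := by
  intro z hz
  have hcont := hK.continuousAt_coneProj a hz
  have hcell : z ∈ closure (cell K) := hK.closure_cell ▸ (hK.mem_hull_face_iff.1 hz).1
  rw [← hK.coneProj_eq_self a hz]
  refine closure_mono ?_ (mem_closure_image hcont hcell)
  exact image_subset_iff.2 fun x hx => hK.coneProj_mem_faceInterior a hx

end IsSimplex

end FaceInterior

section Cells

variable {d : ℕ} {K : Finset (Space d)}

theorem isOpen_cell (K : Finset (Space d)) : IsOpen (cell K) := isOpen_interior

theorem cell_subset_hull (K : Finset (Space d)) : cell K ⊆ hull K := interior_subset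

theorem cell_ae_eq_hull (K : Finset (Space d)) : cell K =ᵐ[volume] hull K :=
  interior_ae_eq_of_null_frontier ((convex_convexHull ℝ _).addHaar_frontier volume)

theorem integrableOn_cell {g : Space d → ℝ} (hg : Continuous g) : IntegrableOn g (cell K) :=
  (hg.continuousOn.integrableOn_compact (isCompact_hull K)).mono_set (cell_subset_hull K)

instance isFiniteMeasure_cell : IsFiniteMeasure (volume.restrict (cell K)) :=
  isFiniteMeasure_restrict.2
    ((measure_mono (cell_subset_hull K)).trans_lt (isCompact_hull K).measure_lt_top).ne

theorem memLp_cell {E : Type*} [NormedAddCommGroup E] {g : Space d → E} (hg : Continuous g)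
    (p : ENNReal) : MemLp g p (volume.restrict (cell K)) := by
  obtain ⟨C, hC⟩ := (isCompact_hull K).exists_bound_of_continuousOn hg.continuousOn
  refine MemLp.of_bound (hg.continuousOn.aestronglyMeasurable_of_subset_isCompact
    (isCompact_hull K) (isOpen_cell K).measurableSet (cell_subset_hull K)) C ?_
  exact (ae_restrict_mem (isOpen_cell K).measurableSet).mono fun x hx =>
    hC x (cell_subset_hull K hx)

end Cells

section Mesh

variable {d : ℕ} {Ω : Set (Space d)} {T : Triangulation Ω} {x : Space d}

theorem isSimplex_elem (K : T.elems) : IsSimplex K.1 := ⟨T.card_eq K K.2, T.indep K K.2⟩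

theorem hull_elem_subset_closure (K : T.elems) : hull K.1 ⊆ closure Ω :=
  T.cover ▸ subset_biUnion_of_mem (u := fun K => hull K) K.2

theorem cell_subset (hreg : interior (closure Ω) = Ω) (K : T.elems) : cell K.1 ⊆ Ω :=
  (interior_mono (hull_elem_subset_closure K)).trans hreg.subset

theorem coord_eq_zero_of_mem_hull {K L : T.elems} (hxK : x ∈ hull K.1) (hxL : x ∈ hull L.1)
    {a : K.1} (ha : ↑a ∉ L.1) : (isSimplex_elem K).coord a x = 0 := by
  refine (isSimplex_elem K).coord_eq_zero_of_mem_face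
    (convexHull_mono (fun b hb => ?_) (T.conforming K K.2 L L.2 ⟨hxK, hxL⟩))
  exact mem_face.2 ⟨fun h => ha (h ▸ hb.2), hb.1⟩

theorem coord_eq_coord_of_mem_hull {K L : T.elems} (hxK : x ∈ hull K.1) (hxL : x ∈ hull L.1)
    {a : Space d} (haK : a ∈ K.1) (haL : a ∈ L.1) :
    (isSimplex_elem K).coord ⟨a, haK⟩ x = (isSimplex_elem L).coord ⟨a, haL⟩ x := by
  let δ : Space d →ᵃ[ℝ] ℝ :=
    (isSimplex_elem K).coord ⟨a, haK⟩ - (isSimplex_elem L).coord ⟨a, haL⟩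
  suffices h : x ∈ δ ⁻¹' {0} from sub_eq_zero.1 h
  refine convexHull_min (fun b hb => ?_) ((convex_singleton 0).affine_preimage δ)
    (T.conforming K K.2 L L.2 ⟨hxK, hxL⟩)
  refine sub_eq_zero.2 ?_
  by_cases hab : a = b
  · subst hab
    exact ((isSimplex_elem K).coord_self ⟨a, haK⟩).trans
      ((isSimplex_elem L).coord_self ⟨a, haL⟩).symm
  · have hK := (isSimplex_elem K).coord_of_ne (a := ⟨a, haK⟩) (b := ⟨b, hb.1⟩) (by simpa using hab)
    have hL := (isSimplex_elem L).coord_of_ne (a := ⟨a, haL⟩) (b := ⟨b, hb.2⟩) (by simpa using hab)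
    exact hK.trans hL.symm

theorem disjoint_cell_hull {K L : T.elems} (hne : K ≠ L) : Disjoint (cell K.1) (hull L.1) := by
  obtain ⟨a, haK, haL⟩ : ∃ a ∈ K.1, a ∉ L.1 := by
    by_contra! h
    exact hne (Subtype.ext (Finset.eq_of_subset_of_card_le h
      (by rw [T.card_eq K K.2, T.card_eq L L.2])))
  refine Set.disjoint_left.2 fun x hxK hxL => ?_
  exact ((isSimplex_elem K).mem_cell_iff.1 hxK ⟨a, haK⟩).ne'
    (coord_eq_zero_of_mem_hull (cell_subset_hull _ hxK) hxL haL)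

theorem mem_faces {e : Finset (Space d)} : e ∈ T.faces ↔ ∃ K ∈ T.elems, e ⊆ K ∧ e.card = d := by
  simp [Triangulation.faces, Finset.mem_powersetCard]

theorem card_of_mem_faces (e : T.faces) : e.1.card = d := by
  obtain ⟨-, -, -, h⟩ := mem_faces.1 e.2
  exact h

theorem exists_face_eq_of_subset {K : T.elems} {e : T.faces} (heK : e.1 ⊆ K.1) :
    ∃ a : K.1, face K.1 a = e.1 :=
  (isSimplex_elem K).exists_face_eq heK (card_of_mem_faces e)

theorem exists_face_eq (e : T.faces) : ∃ (K : T.elems) (a : K.1), face K.1 a = e.1 := by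
  obtain ⟨K, hK, heK, -⟩ := mem_faces.1 e.2
  exact ⟨⟨K, hK⟩, exists_face_eq_of_subset heK⟩

theorem face_mem_faces (K : T.elems) (a : K.1) : face K.1 a ∈ T.faces :=
  mem_faces.2 ⟨K, K.2, face_subset a, (isSimplex_elem K).card_face a⟩

theorem hull_face_subset_closure (e : T.faces) : hull e.1 ⊆ closure Ω := by
  obtain ⟨K, a, h⟩ := exists_face_eq e
  rw [← h]
  exact (convexHull_mono (by exact_mod_cast face_subset a)).trans (hull_elem_subset_closure K)

theorem disjoint_cell_face (K : T.elems) (e : T.faces) : Disjoint (cell K.1) (hull e.1) := by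
  obtain ⟨L, b, he⟩ := exists_face_eq e
  rw [← he]
  rcases eq_or_ne K L with rfl | hne
  · exact Set.disjoint_left.2 fun x hxK hxe => ((isSimplex_elem K).mem_cell_iff.1 hxK b).ne'
      ((isSimplex_elem K).coord_eq_zero_of_mem_face hxe)
  · exact (disjoint_cell_hull hne).mono_right (convexHull_mono (by exact_mod_cast face_subset b))

theorem face_eq_of_mem_faceInterior {K : T.elems} {a : K.1} {e : T.faces}
    (hx : x ∈ (isSimplex_elem K).faceInterior a) (hxe : x ∈ hull e.1) : face K.1 a = e.1 := by
  obtain ⟨L, b, he⟩ := exists_face_eq e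
  rw [← he] at hxe ⊢
  have hxK : x ∈ hull K.1 :=
    ((isSimplex_elem K).mem_hull_face_iff.1 ((isSimplex_elem K).faceInterior_subset a hx)).1
  obtain ⟨hxL, hb⟩ := (isSimplex_elem L).mem_hull_face_iff.1 hxe
  refine Finset.eq_of_subset_of_card_le (fun c hc => ?_)
    (by rw [(isSimplex_elem K).card_face, (isSimplex_elem L).card_face])
  obtain ⟨hca, hcK⟩ := mem_face.1 hc
  have hpos := hx.2 ⟨c, hcK⟩ (Subtype.coe_ne_coe.1 hca)
  have hcL : c ∈ L.1 := by_contra fun h => hpos.ne' (coord_eq_zero_of_mem_hull hxK hxL h)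
  refine mem_face.2 ⟨?_, hcL⟩
  rintro rfl
  exact hpos.ne' ((coord_eq_coord_of_mem_hull hxK hxL hcK hcL).trans hb)

theorem sum_faces (K : T.elems) (G : T.faces → ℝ) :
    ∑ e : T.faces with e.1 ⊆ K.1, G e = ∑ a, G ⟨face K.1 a, face_mem_faces K a⟩ := by
  symm
  refine Finset.sum_bij (fun a _ => ⟨face K.1 a, face_mem_faces K a⟩) ?_ ?_ ?_ fun _ _ => rfl
  · exact fun a _ => Finset.mem_filter.2 ⟨Finset.mem_univ _, face_subset a⟩
  · exact fun a _ b _ h => face_injective K.1 (congrArg Subtype.val h)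
  · intro e he
    obtain ⟨a, ha⟩ := exists_face_eq_of_subset (Finset.mem_filter.1 he).2
    exact ⟨a, Finset.mem_univ a, Subtype.ext ha⟩

theorem sum_elems_faces_comm (P : T.faces → Prop) [DecidablePred P] (F : T.elems → T.faces → ℝ) :
    ∑ K : T.elems, ∑ e : T.faces with e.1 ⊆ K.1 ∧ P e, F K e =
      ∑ e : T.faces with P e, ∑ K : T.elems with e.1 ⊆ K.1, F K e := by
  simp only [Finset.sum_filter]
  rw [Finset.sum_comm]
  refine Finset.sum_congr rfl fun e _ => ?_
  by_cases h : P e <;> simp [h]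

end Mesh

section FaceIntegrals

variable {d : ℕ} [NeZero d] {Ω : Set (Space d)} {T : Triangulation Ω} {x : Space d}

theorem nonempty_of_mem_faces (e : T.faces) : e.1.Nonempty := by
  obtain ⟨K, a, h⟩ := exists_face_eq e
  exact h ▸ (isSimplex_elem K).face_nonempty a

theorem integrableOn_face (e : T.faces) {g : Space d → ℝ} (hg : Continuous g) :
    IntegrableOn g (hull e.1) μHE[d - 1] := by
  obtain ⟨K, a, h⟩ := exists_face_eq e
  exact h ▸ (isSimplex_elem K).integrableOn_face a hg

theorem eq_zero_of_integral_face_eq_zero (e : T.faces) {g : Space d → ℝ} (hg : Continuous g)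
    (h0 : ∀ x ∈ hull e.1, 0 ≤ g x) (hzero : ∫ x in hull e.1, g x ∂μHE[d - 1] = 0)
    (hx : x ∈ hull e.1) : g x = 0 := by
  obtain ⟨K, a, h⟩ := exists_face_eq e
  rw [← h] at h0 hzero hx
  exact (isSimplex_elem K).eq_zero_of_integral_face_eq_zero a hg h0 hzero hx

end FaceIntegrals

section MeshIntegrals

variable {d : ℕ} {Ω : Set (Space d)} {T : Triangulation Ω} {x : Space d}

theorem iUnion_cell_ae_eq (hreg : interior (closure Ω) = Ω) :
    ⋃ K : T.elems, cell K.1 =ᵐ[volume] Ω := by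
  have hsub : ⋃ K : T.elems, cell K.1 ⊆ Ω := iUnion_subset (cell_subset hreg)
  refine Filter.EventuallyLE.antisymm (.of_forall hsub) ?_
  have hae : ∀ᵐ x ∂(volume : Measure (Space d)), ∀ K : T.elems, x ∈ hull K.1 → x ∈ cell K.1 :=
    ae_all_iff.2 fun K => (cell_ae_eq_hull K.1).symm.le
  filter_upwards [hae] with x hx hxΩ
  have hcover : x ∈ ⋃ K ∈ T.elems, hull K := T.cover ▸ subset_closure hxΩ
  obtain ⟨K, hK, hxK⟩ := mem_iUnion₂.1 hcover
  exact mem_iUnion.2 ⟨⟨K, hK⟩, hx _ hxK⟩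

theorem setIntegral_eq_sum_cells (hreg : interior (closure Ω) = Ω) {G : Space d → ℝ}
    {g : T.elems → Space d → ℝ} (hgi : ∀ K, IntegrableOn (g K) (cell K.1))
    (heq : ∀ K, EqOn G (g K) (cell K.1)) :
    ∫ x in Ω, G x = ∑ K : T.elems, ∫ x in cell K.1, g K x := by
  have hmeas (K : T.elems) := (isOpen_cell K.1).measurableSet
  rw [← setIntegral_congr_set (iUnion_cell_ae_eq (T := T) hreg), integral_iUnion_fintype hmeas]
  · exact Finset.sum_congr rfl fun K _ => setIntegral_congr_fun (hmeas K) (heq K)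
  · exact fun K L hKL => (disjoint_cell_hull hKL).mono_right (cell_subset_hull _)
  · exact fun K => (hgi K).congr_fun (heq K).symm (hmeas K)

theorem isFiniteMeasure_restrict_domain (T : Triangulation Ω) :
    IsFiniteMeasure (volume.restrict Ω) := by
  have hcompact : IsCompact (closure Ω) :=
    T.cover ▸ T.elems.finite_toSet.isCompact_biUnion fun K _ => isCompact_hull K
  exact isFiniteMeasure_restrict.2
    ((measure_mono subset_closure).trans_lt hcompact.measure_lt_top).ne

/-- The function that is `g K` on each open element `K`. -/
def pwFun {E : Type*} [AddCommMonoid E] (g : T.elems → Space d → E) (x : Space d) : E :=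
  ∑ K : T.elems, (cell K.1).indicator (g K) x

theorem pwFun_eq {E : Type*} [AddCommMonoid E] (g : T.elems → Space d → E) {K : T.elems}
    (hx : x ∈ cell K.1) : pwFun g x = g K x := by
  rw [pwFun, Finset.sum_eq_single K (fun L _ hL => ?_) (by simp), indicator_of_mem hx]
  exact indicator_of_notMem (fun h => (disjoint_cell_hull hL.symm).le_bot
    ⟨hx, cell_subset_hull _ h⟩) _

theorem memLp_pwFun {E : Type*} [NormedAddCommGroup E] {g : T.elems → Space d → E}
    (hg : ∀ K, Continuous (g K)) (p : ENNReal) : MemLp (pwFun g) p (volume.restrict Ω) :=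
  (memLp_finsetSum _ fun K _ => (memLp_indicator_iff_restrict
    (isOpen_cell K.1).measurableSet).2 (memLp_cell (hg K) p)).restrict Ω

end MeshIntegrals

/-! ### Weak divergence of piecewise polynomial fields -/

section WeakDivergence

variable {d : ℕ} {Ω : Set (Space d)} {T : Triangulation Ω} {q : T.elems → Fin d → Poly d}
  {x y : Space d} {φ : Space d → ℝ}

/-- The piecewise polynomial vector field that is `q K` on each open element `K`. -/
def pwField (q : T.elems → Fin d → Poly d) : Space d → Space d :=
  pwFun fun K x => vecEvalAt x (q K)

/-- The elementwise divergence of `pwField q`. -/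
def pwDiv (q : T.elems → Fin d → Poly d) : Space d → ℝ :=
  pwFun fun K x => evalAt x (polyDiv (q K))

/-- The sum of the exterior normal components on the face `e` of the fields of the elements
adjacent to `e`, which is the jump of the normal component if there are two of them. -/
def normalJump (q : T.elems → Fin d → Poly d) (e : Finset (Space d)) (x : Space d) : ℝ :=
  ∑ K : T.elems with e ⊆ K.1, normalTrace K.1 e (q K) x

theorem normalJump_eq_evalAt (q : T.elems → Fin d → Poly d) (e : Finset (Space d)) (x : Space d) :
    normalJump q e x =
      evalAt x (∑ K : T.elems with e ⊆ K.1, ∑ i, outwardNormal K.1 e i • q K i) := by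
  simp [normalJump, normalTrace, inner_vecEvalAt]

@[fun_prop]
theorem continuous_normalJump (q : T.elems → Fin d → Poly d) (e : Finset (Space d)) :
    Continuous (normalJump q e) :=
  continuous_finsetSum _ fun K _ => continuous_normalTrace K.1 e (q K)

theorem memLp_pwField (p : ENNReal) : MemLp (pwField q) p (volume.restrict Ω) :=
  memLp_pwFun (fun K => continuous_vecEvalAt (q K)) p

theorem memLp_pwDiv (p : ENNReal) : MemLp (pwDiv q) p (volume.restrict Ω) :=
  memLp_pwFun (fun K => continuous_evalAt (polyDiv (q K))) p

theorem eq_zero_of_mem_frontier (hopen : IsOpen Ω) (hsupp : tsupport φ ⊆ Ω)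
    (hx : x ∈ frontier Ω) : φ x = 0 :=
  image_eq_zero_of_notMem_tsupport fun h => (hopen.frontier_eq ▸ hx).2 (hsupp h)

section Identities

variable [NeZero d]

theorem integral_cell_div (hφ : ContDiff ℝ 1 φ) (K : T.elems) (q : Fin d → Poly d) :
    ∫ x in cell K.1, (fderiv ℝ φ x (vecEvalAt x q) + φ x * evalAt x (polyDiv q)) =
      ∑ e : T.faces with e.1 ⊆ K.1, ∫ x in hull e.1, φ x * normalTrace K.1 e.1 q x ∂μHE[d - 1] := by
  rw [setIntegral_congr_set (cell_ae_eq_hull K.1), (isSimplex_elem K).integral_div hφ q,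
    sum_faces K fun e => ∫ x in hull e.1, φ x * normalTrace K.1 e.1 q x ∂μHE[d - 1]]

theorem sum_integral_cell_div (hφ : ContDiff ℝ 1 φ) (q : T.elems → Fin d → Poly d) :
    ∑ K : T.elems, ∫ x in cell K.1,
        (fderiv ℝ φ x (vecEvalAt x (q K)) + φ x * evalAt x (polyDiv (q K))) =
      ∑ e : T.faces, ∫ x in hull e.1, φ x * normalJump q e.1 x ∂μHE[d - 1] := by
  have hcomm := sum_elems_faces_comm (T := T) (fun _ => True) fun K e =>
    ∫ x in hull e.1, φ x * normalTrace K.1 e.1 (q K) x ∂μHE[d - 1]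
  simp only [and_true, Finset.filter_true] at hcomm
  simp_rw [integral_cell_div hφ, hcomm, normalJump, Finset.mul_sum]
  refine Finset.sum_congr rfl fun e _ => (integral_finsetSum _ fun K _ => ?_).symm
  exact integrableOn_face e (hφ.continuous.mul (continuous_normalTrace _ _ _))

theorem integral_fderiv_pwField_add (hreg : interior (closure Ω) = Ω) (hφ : ContDiff ℝ 1 φ)
    (q : T.elems → Fin d → Poly d) :
    (∫ x in Ω, fderiv ℝ φ x (pwField q x)) + ∫ x in Ω, pwDiv q x * φ x =
      ∑ e : T.faces, ∫ x in hull e.1, φ x * normalJump q e.1 x ∂μHE[d - 1] := by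
  have hderiv (K : T.elems) :
      IntegrableOn (fun x => fderiv ℝ φ x (vecEvalAt x (q K))) (cell K.1) :=
    integrableOn_cell ((hφ.continuous_fderiv one_ne_zero).clm_apply (continuous_vecEvalAt _))
  have hdiv (K : T.elems) : IntegrableOn (fun x => φ x * evalAt x (polyDiv (q K))) (cell K.1) :=
    integrableOn_cell (hφ.continuous.mul (continuous_evalAt _))
  rw [← sum_integral_cell_div hφ q,
    setIntegral_eq_sum_cells hreg hderiv fun K x hx => by simp only [pwField, pwFun_eq _ hx],
    setIntegral_eq_sum_cells hreg hdiv fun K x hx => by simp only [pwDiv, pwFun_eq _ hx, mul_comm],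
    ← Finset.sum_add_distrib]
  exact Finset.sum_congr rfl fun K _ => (integral_add (hderiv K) (hdiv K)).symm

theorem hasWeakDiv_pwDiv_iff (hreg : interior (closure Ω) = Ω) :
    HasWeakDiv Ω (pwField q) (pwDiv q) ↔
      ∀ φ : Space d → ℝ, ContDiff ℝ ∞ φ → HasCompactSupport φ → tsupport φ ⊆ Ω →
        ∑ e : T.faces, ∫ x in hull e.1, φ x * normalJump q e.1 x ∂μHE[d - 1] = 0 := by
  refine forall_congr' fun φ => forall_congr' fun hφ => ?_
  rw [← integral_fderiv_pwField_add hreg (hφ.of_le (by norm_cast)) q]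
  simp only [eq_neg_iff_add_eq_zero]

theorem hasWeakDiv_of_normalJump_eq_zero (hreg : interior (closure Ω) = Ω)
    (hq : ∀ e : T.faces, ¬ OnBoundary Ω e.1 → ∀ x ∈ hull e.1, normalJump q e.1 x = 0) :
    HasWeakDiv Ω (pwField q) (pwDiv q) := by
  refine (hasWeakDiv_pwDiv_iff hreg).2 fun φ _ _ hsupp => Finset.sum_eq_zero fun e _ =>
    setIntegral_eq_zero_of_forall_eq_zero fun x hx => ?_
  by_cases hb : OnBoundary Ω e.1
  · rw [eq_zero_of_mem_frontier (hreg ▸ isOpen_interior) hsupp (hb hx), zero_mul]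
  · rw [hq e hb x hx, mul_zero]

theorem ae_eq_of_hasWeakDiv (hreg : interior (closure Ω) = Ω) {g : Space d → ℝ}
    (hg : IntegrableOn g Ω) (h : HasWeakDiv Ω (pwField q) g) :
    g =ᵐ[volume.restrict Ω] pwDiv q := by
  let U : Set (Space d) := ⋃ K : T.elems, cell K.1
  have hU : IsOpen U := isOpen_iUnion fun K => isOpen_cell K.1
  have hUΩ : U ⊆ Ω := iUnion_subset (cell_subset hreg)
  have hdiv : IntegrableOn (pwDiv q) Ω := memLp_one_iff_integrable.1 (memLp_pwDiv 1)
  rw [← Measure.restrict_congr_set (iUnion_cell_ae_eq (T := T) hreg), Filter.EventuallyEq,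
    ae_restrict_iff' hU.measurableSet]
  refine (hU.ae_eq_zero_of_integral_contDiff_smul_eq_zero
    ((hg.sub hdiv).mono_set hUΩ).locallyIntegrableOn fun φ hφ hcomp hsupp => ?_).mono
      fun x hx hxU => sub_eq_zero.1 (hx hxU)
  have hfaces : ∑ e : T.faces, ∫ x in hull e.1, φ x * normalJump q e.1 x ∂μHE[d - 1] = 0 := by
    refine Finset.sum_eq_zero fun e _ => setIntegral_eq_zero_of_forall_eq_zero fun x hx => ?_
    refine mul_eq_zero_of_left (image_eq_zero_of_notMem_tsupport fun hxφ => ?_) _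
    obtain ⟨K, hxK⟩ := mem_iUnion.1 (hsupp hxφ)
    exact (disjoint_cell_face K e).le_bot ⟨hxK, hx⟩
  have hident := integral_fderiv_pwField_add hreg (hφ.of_le (by norm_cast)) q
  rw [hfaces, h φ hφ hcomp (hsupp.trans hUΩ), neg_add_eq_zero] at hident
  obtain ⟨C, hC⟩ := hφ.continuous.bounded_above_of_compact_support hcomp
  have hmul {G : Space d → ℝ} (hG : IntegrableOn G Ω volume) :
      Integrable (fun x => G x * φ x) (volume.restrict Ω) :=
    Integrable.mul_bdd (c := C) hG hφ.continuous.aestronglyMeasurable (.of_forall hC)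
  rw [← setIntegral_eq_integral_of_forall_compl_eq_zero (s := Ω) fun x hx => by
    rw [image_eq_zero_of_notMem_tsupport fun h => hx (hUΩ (hsupp h)), zero_smul]]
  simp only [smul_eq_mul, mul_comm (φ _), Pi.sub_apply, sub_mul]
  rw [integral_sub (hmul hg) (hmul hdiv), hident, sub_self]

theorem hasWeakDiv_pwDiv_of_hasWeakDiv (hreg : interior (closure Ω) = Ω) {g : Space d → ℝ}
    (hg : IntegrableOn g Ω) (h : HasWeakDiv Ω (pwField q) g) :
    HasWeakDiv Ω (pwField q) (pwDiv q) := by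
  intro φ hφ hcomp hsupp
  rw [h φ hφ hcomp hsupp]
  exact congrArg _ (integral_congr_ae ((ae_eq_of_hasWeakDiv hreg hg h).mono fun x hx => by
    simp only [hx]))

/-- A test function concentrated near a relatively interior point of a face sees no other face. -/
theorem normalJump_eq_zero_of_mem_faceInterior (hreg : interior (closure Ω) = Ω)
    (h : HasWeakDiv Ω (pwField q) (pwDiv q)) {K : T.elems} {a : K.1}
    (hx : x ∈ (isSimplex_elem K).faceInterior a) (hxΩ : x ∈ Ω) :
    normalJump q (face K.1 a) x = 0 := by
  by_contra hne
  let e : T.faces := ⟨face K.1 a, face_mem_faces K a⟩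
  let V : Set (Space d) := (Ω ∩ ⋂ e' ∈ Finset.univ.erase e, (hull e'.1)ᶜ) ∩
    {z | 0 < normalJump q e.1 z * normalJump q e.1 x}
  have hV : IsOpen V := by
    have hΩ : IsOpen Ω := hreg ▸ isOpen_interior
    refine (hΩ.inter (isOpen_biInter_finset fun e' _ => (isClosed_hull e'.1).isOpen_compl)).inter ?_
    exact isOpen_lt continuous_const (by fun_prop)
  have hxV : x ∈ V := ⟨⟨hxΩ, mem_iInter₂.2 fun e' he' hxe' => (Finset.mem_erase.1 he').1
    (Subtype.ext (face_eq_of_mem_faceInterior hx hxe').symm)⟩, mul_self_pos.2 hne⟩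
  obtain ⟨φ, hsupp, hcomp, hφ, hrange, hφx⟩ :=
    exists_contDiff_tsupport_subset (n := ⊤) (hV.mem_nhds hxV)
  have hφ0 (z : Space d) (hz : z ∉ V) : φ z = 0 :=
    image_eq_zero_of_notMem_tsupport fun h => hz (hsupp h)
  have hzero := (hasWeakDiv_pwDiv_iff hreg).1 h φ hφ hcomp (hsupp.trans fun z hz => hz.1.1)
  rw [Finset.sum_eq_single e (fun e' _ hne' => setIntegral_eq_zero_of_forall_eq_zero fun z hz => by
      rw [hφ0 z fun hzV => mem_iInter₂.1 hzV.1.2 e' (by simpa using hne') hz, zero_mul])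
    (by simp)] at hzero
  have hzero := eq_zero_of_integral_face_eq_zero e
    (g := fun z => φ z * normalJump q e.1 z * normalJump q e.1 x)
    ((hφ.continuous.mul (continuous_normalJump q e.1)).mul continuous_const) (fun z _ => ?_)
    (by rw [integral_mul_const, hzero, zero_mul]) ((isSimplex_elem K).faceInterior_subset a hx)
  · simp only [hφx, one_mul] at hzero
    exact hne (mul_self_eq_zero.1 hzero)
  · by_cases hz : z ∈ V
    · rw [mul_assoc]
      exact mul_nonneg (hrange ⟨z, rfl⟩).1 (le_of_lt hz.2)
    · simp [hφ0 z hz]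

theorem exists_mem_faceInterior {K : T.elems} {a : K.1} (hopen : IsOpen Ω)
    (hb : ¬ OnBoundary Ω (face K.1 a)) : ∃ x ∈ (isSimplex_elem K).faceInterior a, x ∈ Ω := by
  obtain ⟨z, hz, hzb⟩ := not_subset.1 hb
  have hzΩ : z ∈ Ω := by
    by_contra hzΩ
    refine hzb (hopen.frontier_eq ▸ ⟨?_, hzΩ⟩)
    exact hull_face_subset_closure ⟨face K.1 a, face_mem_faces K a⟩ hz
  obtain ⟨x, hxΩ, hx⟩ := mem_closure_iff.1
    ((isSimplex_elem K).hull_face_subset_closure_faceInterior a hz) Ω hopen hzΩ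
  exact ⟨x, hx, hxΩ⟩

theorem normalJump_eq_zero (hreg : interior (closure Ω) = Ω) {g : Space d → ℝ}
    (hg : IntegrableOn g Ω) (h : HasWeakDiv Ω (pwField q) g) (e : T.faces)
    (hb : ¬ OnBoundary Ω e.1) (hy : y ∈ hull e.1) : normalJump q e.1 y = 0 := by
  have hopen : IsOpen Ω := hreg ▸ isOpen_interior
  obtain ⟨K, a, he⟩ := exists_face_eq e
  rw [← he] at hb hy ⊢
  obtain ⟨x, hx, hxΩ⟩ := exists_mem_faceInterior hopen hb
  let γ : ℝ →ᵃ[ℝ] Space d := AffineMap.lineMap x y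
  have hnear : ∀ᶠ t in nhds 0, γ t ∈ (isSimplex_elem K).faceInterior a ∧ γ t ∈ Ω :=
    ((isSimplex_elem K).eventually_lineMap_mem_faceInterior a hx hy).and
      ((AffineMap.lineMap_continuous (p := x) (q := y)).continuousAt.eventually
        (hopen.mem_nhds (by simpa using hxΩ)))
  have hanalytic : AnalyticOnNhd ℝ (fun t => normalJump q (face K.1 a) (γ t)) univ := by
    simp only [normalJump_eq_evalAt]
    have hγ : AnalyticOnNhd ℝ γ univ := by
      rw [show ⇑γ = fun t => (1 - t) • x + t • y from
        funext fun t => AffineMap.lineMap_apply_module x y t]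
      exact fun t _ => by fun_prop
    exact (analyticOnNhd_evalAt _).comp hγ (mapsTo_univ _ _)
  have hzero := hanalytic.eq_of_eventuallyEq (g := 0) analyticOnNhd_const (z₀ := 0)
    (hnear.mono fun t ht => normalJump_eq_zero_of_mem_faceInterior hreg
      (hasWeakDiv_pwDiv_of_hasWeakDiv hreg hg h) ht.1 ht.2)
  simpa [γ] using congrFun hzero 1

theorem weakDiv_ae_eq (hreg : interior (closure Ω) = Ω) (h : MemHdiv Ω (pwField q)) :
    weakDiv Ω (pwField q) =ᵐ[volume.restrict Ω] pwDiv q := by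
  have := isFiniteMeasure_restrict_domain T
  rw [weakDiv, dif_pos h.2]
  exact ae_eq_of_hasWeakDiv hreg (h.2.choose_spec.1.integrable one_le_two) h.2.choose_spec.2

theorem memHdiv_iff (hreg : interior (closure Ω) = Ω) :
    MemHdiv Ω (pwField q) ↔
      ∀ e : T.faces, ¬ OnBoundary Ω e.1 → ∀ x ∈ hull e.1, normalJump q e.1 x = 0 := by
  have := isFiniteMeasure_restrict_domain T
  constructor
  · rintro ⟨-, g, hg, h⟩ e hb x hx
    exact normalJump_eq_zero hreg (hg.integrable one_le_two) h e hb hx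
  · exact fun h => ⟨memLp_pwField 2, _, memLp_pwDiv 2, hasWeakDiv_of_normalJump_eq_zero hreg h⟩

end Identities

end WeakDivergence

/-! ### The forms of the two systems -/

section IntegralForm

variable {X E F : Type*} [MeasurableSpace X] {m : Measure X} [AddCommGroup E] [Module ℝ E]
  [AddCommGroup F] [Module ℝ F]

/-- The integral of a family of linear functionals. -/
def integralFunctional (ℓ : X → F →ₗ[ℝ] ℝ) (hℓ : ∀ v, Integrable (fun x => ℓ x v) m) :
    F →ₗ[ℝ] ℝ where
  toFun v := ∫ x, ℓ x v ∂m
  map_add' v w := by simpa only [map_add] using integral_add (hℓ v) (hℓ w)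
  map_smul' c v := by simpa using integral_const_mul c fun x => ℓ x v

/-- The integral of a family of bilinear forms. -/
def integralForm (β : X → E →ₗ[ℝ] F →ₗ[ℝ] ℝ) (hβ : ∀ u v, Integrable (fun x => β x u v) m) :
    E →ₗ[ℝ] F →ₗ[ℝ] ℝ where
  toFun u := integralFunctional (fun x => β x u) (hβ u)
  map_add' u u' := LinearMap.ext fun v => by
    simpa [integralFunctional] using integral_add (hβ u v) (hβ u' v)
  map_smul' c u := LinearMap.ext fun v => by
    simpa [integralFunctional] using integral_const_mul c fun x => β x u v

@[simp]
theorem integralFunctional_apply (ℓ : X → F →ₗ[ℝ] ℝ) (hℓ : ∀ v, Integrable (fun x => ℓ x v) m)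
    (v : F) : integralFunctional ℓ hℓ v = ∫ x, ℓ x v ∂m := rfl

@[simp]
theorem integralForm_apply (β : X → E →ₗ[ℝ] F →ₗ[ℝ] ℝ)
    (hβ : ∀ u v, Integrable (fun x => β x u v) m) (u : E) (v : F) :
    integralForm β hβ u v = ∫ x, β x u v ∂m := rfl

end IntegralForm

section ElementForms

variable {d k : ℕ} {Ω : Set (Space d)} {T : Triangulation Ω} {κ f : Space d → ℝ}

theorem integrableOn_mul_cell {w g : Space d → ℝ} {K : Finset (Space d)}
    (hw : IntegrableOn w (cell K)) (hg : Continuous g) :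
    IntegrableOn (fun x => w x * g x) (cell K) :=
  hw.mul_continuousOn_of_subset hg.continuousOn (isOpen_cell K).measurableSet
    (isCompact_hull K) (cell_subset_hull K)

/-- The value at `x` of the polynomial that `w` assigns to the element `K`. -/
def scalarAt (K : T.elems) (x : Space d) : Wh T k →ₗ[ℝ] ℝ :=
  evalAt x ∘ₗ (Pk d k).subtype ∘ₗ LinearMap.proj K

/-- The value at `x` of the polynomial field that `q` assigns to the element `K`. -/
def fieldAt (K : T.elems) (x : Space d) : Vh T k →ₗ[ℝ] Space d where
  toFun q := vecEvalAt x (q K).1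
  map_add' q r := by ext i; simp [vecEvalAt]
  map_smul' c q := by ext i; simp [vecEvalAt]

/-- The value at `x` of the divergence of the polynomial field that `q` assigns to `K`. -/
def divAt (K : T.elems) (x : Space d) : Vh T k →ₗ[ℝ] ℝ where
  toFun q := evalAt x (polyDiv (q K).1)
  map_add' q r := by simp [polyDiv, Finset.sum_add_distrib]
  map_smul' c q := by simp [polyDiv, Finset.mul_sum]

/-- `massForm` as a bilinear map. -/
def massBilin (hκ : ∀ K : T.elems, IntegrableOn (fun x => (κ x)⁻¹) (cell K.1)) :
    Vh T k →ₗ[ℝ] Vh T k →ₗ[ℝ] ℝ :=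
  ∑ K : T.elems, integralForm (m := volume.restrict (cell K.1))
    (fun x => (κ x)⁻¹ • (innerₗ (Space d)).compl₁₂ (fieldAt K x) (fieldAt K x))
    fun q r => integrableOn_mul_cell (hκ K)
      ((continuous_vecEvalAt (q K).1).inner (continuous_vecEvalAt (r K).1))

/-- `divForm` as a bilinear map. -/
def divBilin (T : Triangulation Ω) (k : ℕ) : Wh T k →ₗ[ℝ] Vh T k →ₗ[ℝ] ℝ :=
  ∑ K : T.elems, integralForm (m := volume.restrict (cell K.1))
    (fun x => (LinearMap.mul ℝ ℝ).compl₁₂ (scalarAt K x) (divAt K x))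
    fun w q => integrableOn_cell
      ((continuous_evalAt (w K).1).mul (continuous_evalAt (polyDiv (q K).1)))

/-- `loadForm` as a linear functional. -/
def loadFunctional (hf : ∀ K : T.elems, IntegrableOn f (cell K.1)) : Wh T k →ₗ[ℝ] ℝ :=
  ∑ K : T.elems, integralFunctional (m := volume.restrict (cell K.1))
    (fun x => f x • scalarAt K x) fun w => integrableOn_mul_cell (hf K) (continuous_evalAt (w K).1)

theorem massBilin_apply (hκ : ∀ K : T.elems, IntegrableOn (fun x => (κ x)⁻¹) (cell K.1))
    (q r : Vh T k) : massBilin hκ q r = massForm κ q r := by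
  simp only [massBilin, LinearMap.sum_apply]
  rfl

theorem divBilin_apply (w : Wh T k) (q : Vh T k) : divBilin T k w q = divForm w q := by
  simp only [divBilin, LinearMap.sum_apply]
  rfl

theorem loadFunctional_apply (hf : ∀ K : T.elems, IntegrableOn f (cell K.1)) (w : Wh T k) :
    loadFunctional hf w = loadForm f w := by
  simp only [loadFunctional, LinearMap.sum_apply]
  rfl

end ElementForms

section FaceForms

variable {d k : ℕ} {Ω : Set (Space d)} {T : Triangulation Ω} {u₀ : Space d → ℝ}
  {e : Finset (Space d)}

/-- The surface measure on a face. -/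
abbrev faceMeasure (e : Finset (Space d)) : Measure (hull e) :=
  Measure.comap Subtype.val (μHE[d - 1] : Measure (Space d))

theorem faceIntegral_eq (e : Finset (Space d)) (g : Space d → ℝ) :
    faceIntegral e (fun x => g x) = ∫ x in hull e, g x ∂μHE[d - 1] :=
  integral_subtype_comap (isClosed_hull e).measurableSet g

theorem exists_evalAt_eq_of_mem_facePk {g : hull e → ℝ} (hg : g ∈ facePk k e) :
    ∃ p ∈ Pk d k, ∀ x : hull e, g x = evalAt (x : Space d) p := by
  obtain ⟨p, hp, rfl⟩ := hg
  exact ⟨p, hp, fun x => rfl⟩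

theorem continuous_of_mem_facePk {g : hull e → ℝ} (hg : g ∈ facePk k e) : Continuous g := by
  obtain ⟨p, -, hp⟩ := exists_evalAt_eq_of_mem_facePk hg
  exact ((continuous_evalAt p).comp continuous_subtype_val).congr fun x => (hp x).symm

theorem integrable_mul_face {w g : hull e → ℝ} (hw : Integrable w (faceMeasure e))
    (hg : Continuous g) : Integrable (fun x => w x * g x) (faceMeasure e) := by
  have : CompactSpace (hull e) := isCompact_iff_compactSpace.1 (isCompact_hull e)
  rw [← integrableOn_univ] at hw ⊢
  exact hw.mul_continuousOn hg.continuousOn isCompact_univ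

/-- The value at `x` of the polynomial function that `μ` assigns to the face `e`. -/
def traceAt (e : T.faces) (x : hull e.1) : Mh T k →ₗ[ℝ] ℝ :=
  LinearMap.proj x ∘ₗ (facePk k e.1).subtype ∘ₗ LinearMap.proj e

open Classical in
/-- The faces on `∂Ω`. -/
def boundaryFaces (T : Triangulation Ω) : Finset T.faces := {e | OnBoundary Ω e.1}

open Classical in
/-- The faces that are not on `∂Ω`. -/
def interiorFaces (T : Triangulation Ω) : Finset T.faces := {e | ¬ OnBoundary Ω e.1}

@[simp]
theorem mem_boundaryFaces {e : T.faces} : e ∈ boundaryFaces T ↔ OnBoundary Ω e.1 := by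
  simp [boundaryFaces]

@[simp]
theorem mem_interiorFaces {e : T.faces} : e ∈ interiorFaces T ↔ ¬ OnBoundary Ω e.1 := by
  simp [interiorFaces]

theorem integrable_boundaryFace (hu₀ : IntegrableOn u₀ (frontier Ω) μHE[d - 1]) {e : T.faces}
    (he : e ∈ boundaryFaces T) : Integrable (fun x : hull e.1 => u₀ x) (faceMeasure e.1) :=
  (integrableOn_iff_comap_subtypeVal (isClosed_hull e.1).measurableSet).1
    (hu₀.mono_set (mem_boundaryFaces.1 he))

/-- `boundaryLoad` as a linear functional. -/
def boundaryLoadFunctional (hu₀ : IntegrableOn u₀ (frontier Ω) μHE[d - 1]) :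
    Mh T k →ₗ[ℝ] ℝ :=
  ∑ e ∈ (boundaryFaces T).attach, integralFunctional (m := faceMeasure e.1.1)
    (fun x => u₀ x • traceAt e.1 x)
    fun μ =>
      integrable_mul_face (integrable_boundaryFace hu₀ e.2) (continuous_of_mem_facePk (μ e.1).2)

theorem boundaryLoadFunctional_apply (hu₀ : IntegrableOn u₀ (frontier Ω) μHE[d - 1])
    (μ : Mh T k) : boundaryLoadFunctional hu₀ μ = boundaryLoad u₀ μ := by
  simp only [boundaryLoadFunctional, LinearMap.sum_apply, integralFunctional_apply]
  exact Finset.sum_attach (boundaryFaces T) fun e => faceIntegral e.1 fun x => u₀ x * (μ e).1 x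

variable [NeZero d]

theorem integrable_face (e : T.faces) {g : hull e.1 → ℝ} (hg : Continuous g) :
    Integrable g (faceMeasure e.1) := by
  have hone : Integrable (fun _ : hull e.1 => (1 : ℝ)) (faceMeasure e.1) :=
    (integrableOn_iff_comap_subtypeVal (isClosed_hull e.1).measurableSet).1
      (integrableOn_face e continuous_const)
  simpa only [one_mul] using integrable_mul_face hone hg

/-- The inner product of `L²(S)`, where `S` is the union of the faces in `s`. -/
def skeletonForm (s : Finset T.faces) : Mh T k →ₗ[ℝ] Mh T k →ₗ[ℝ] ℝ :=
  ∑ e ∈ s, integralForm (m := faceMeasure e.1)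
    (fun x => (LinearMap.mul ℝ ℝ).compl₁₂ (traceAt e x) (traceAt e x))
    fun lam μ => integrable_face e
      ((continuous_of_mem_facePk (lam e).2).mul (continuous_of_mem_facePk (μ e).2))

theorem skeletonForm_apply (s : Finset T.faces) (lam μ : Mh T k) :
    skeletonForm s lam μ = ∑ e ∈ s, faceIntegral e.1 fun x => (lam e).1 x * (μ e).1 x := by
  simp only [skeletonForm, LinearMap.sum_apply, integralForm_apply]
  rfl

theorem normalJump_mem_facePk (q : Vh T k) (e : T.faces) :
    (fun x : hull e.1 => normalJump (fun K => (q K).1) e.1 x) ∈ facePk k e.1 := by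
  choose p hp hpq using fun K : T.elems =>
    exists_evalAt_eq_normalTrace (K := K.1) (q K).2 (nonempty_of_mem_faces e)
  refine ⟨∑ K : T.elems with e.1 ⊆ K.1, p K, sum_mem fun K _ => hp K, funext fun x => ?_⟩
  simp [normalJump, hpq _ x x.2]

/-- The normal jumps of `q`, as an element of `M_h`. -/
def faceJump : Vh T k →ₗ[ℝ] Mh T k where
  toFun q e := ⟨fun x => normalJump (fun K => (q K).1) e.1 x, normalJump_mem_facePk q e⟩
  map_add' q r := funext fun e => Subtype.ext <| funext fun x => by
    simp [normalJump_eq_evalAt, Finset.sum_add_distrib]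
  map_smul' c q := funext fun e => Subtype.ext <| funext fun x => by
    simp [normalJump_eq_evalAt, Finset.mul_sum, mul_left_comm]

theorem skeletonForm_faceJump (s : Finset T.faces) (μ : Mh T k) (q : Vh T k) :
    skeletonForm s μ (faceJump q) = ∑ e ∈ s, ∑ K : T.elems with e.1 ⊆ K.1,
      faceIntegral e.1 fun x => (μ e).1 x * normalTrace K.1 e.1 (q K).1 x := by
  rw [skeletonForm_apply]
  refine Finset.sum_congr rfl fun e _ => ?_
  simp only [faceIntegral, faceJump, LinearMap.coe_mk, AddHom.coe_mk, normalJump, Finset.mul_sum]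
  refine integral_finsetSum _ fun K _ => integrable_face e
    ((continuous_of_mem_facePk (μ e).2).mul ?_)
  exact (continuous_normalTrace K.1 e.1 (q K).1).comp continuous_subtype_val

theorem traceForm_eq (μ : Mh T k) (q : Vh T k) :
    traceForm μ q = skeletonForm Finset.univ μ (faceJump q) := by
  have hcomm := sum_elems_faces_comm (T := T) (fun _ => True) fun K e =>
    faceIntegral e.1 fun x => (μ e).1 x * normalTrace K.1 e.1 (q K).1 x
  simp only [and_true, Finset.filter_true] at hcomm
  rw [skeletonForm_faceJump, ← hcomm]
  rfl

theorem interiorTraceForm_eq (q : Vh T k) (μ : Mh T k) :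
    interiorTraceForm q μ = skeletonForm (interiorFaces T) μ (faceJump q) := by
  classical
  rw [skeletonForm_faceJump, interiorFaces, ← sum_elems_faces_comm]
  simp only [interiorTraceForm, mul_comm]

theorem boundaryForm_eq (lam μ : Mh T k) :
    boundaryForm lam μ = skeletonForm (boundaryFaces T) lam μ :=
  (skeletonForm_apply _ lam μ).symm

theorem boundaryFluxLoad_eq (hu₀ : IntegrableOn u₀ (frontier Ω) μHE[d - 1])
    (q : Vh T k) : boundaryFluxLoad u₀ q = boundaryLoad u₀ (faceJump q) := by
  classical
  rw [boundaryFluxLoad, sum_elems_faces_comm (fun e => OnBoundary Ω e.1) fun K e =>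
    faceIntegral e.1 fun x => u₀ x * normalTrace K.1 e.1 (q K).1 x]
  refine Finset.sum_congr rfl fun e he => ?_
  simp only [faceIntegral, faceJump, LinearMap.coe_mk, AddHom.coe_mk, normalJump, Finset.mul_sum]
  refine (integral_finsetSum _ fun K _ =>
    integrable_mul_face (integrable_boundaryFace hu₀ he) ?_).symm
  exact (continuous_normalTrace K.1 e.1 (q K).1).comp continuous_subtype_val

theorem traceForm_eq_add (μ : Mh T k) (q : Vh T k) :
    traceForm μ q = interiorTraceForm q μ + boundaryForm μ (faceJump q) := by
  classical
  rw [traceForm_eq, interiorTraceForm_eq, boundaryForm_eq, add_comm]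
  simp only [skeletonForm_apply]
  exact (Finset.sum_filter_add_sum_filter_not _ _ _).symm

theorem eq_zero_of_skeletonForm_self {s : Finset T.faces} {μ : Mh T k}
    (h : skeletonForm s μ μ = 0) {e : T.faces} (he : e ∈ s) : μ e = 0 := by
  have hnonneg (e : T.faces) : 0 ≤ faceIntegral e.1 fun x => (μ e).1 x * (μ e).1 x :=
    integral_nonneg fun x => mul_self_nonneg _
  rw [skeletonForm_apply, Finset.sum_eq_zero_iff_of_nonneg fun e _ => hnonneg e] at h
  obtain ⟨p, -, hp⟩ := exists_evalAt_eq_of_mem_facePk (μ e).2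
  have hzero := h e he
  simp only [hp, faceIntegral_eq e.1 fun x => evalAt x p * evalAt x p] at hzero
  ext x
  have := eq_zero_of_integral_face_eq_zero e ((continuous_evalAt p).mul (continuous_evalAt p))
    (fun x _ => mul_self_nonneg _) hzero x.2
  exact (hp x).trans (mul_self_eq_zero.1 this)

end FaceForms

section Systems

variable {d k : ℕ} {Ω : Set (Space d)} {T : Triangulation Ω} {κ f u₀ : Space d → ℝ}
  {q r : Vh T k} {u : Wh T k} {uhat : Mh T k}

theorem setIntegral_vectorFun (hreg : interior (closure Ω) = Ω)
    (hκ : IntegrableOn (fun x => (κ x)⁻¹) Ω) (q r : Vh T k) :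
    ∫ x in Ω, (κ x)⁻¹ * inner ℝ (vectorFun q x) (vectorFun r x) = massForm κ q r := by
  refine setIntegral_eq_sum_cells hreg (fun K => ?_) fun K x hx => ?_
  · exact integrableOn_mul_cell (hκ.mono_set (cell_subset hreg K))
      ((continuous_vecEvalAt (q K).1).inner (continuous_vecEvalAt (r K).1))
  · exact congrArg₂ (fun y z => (κ x)⁻¹ * inner ℝ y z) (pwFun_eq _ hx) (pwFun_eq _ hx)

theorem setIntegral_scalarFun (hreg : interior (closure Ω) = Ω) (hf : IntegrableOn f Ω)
    (w : Wh T k) : ∫ x in Ω, f x * scalarFun w x = loadForm f w := by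
  refine setIntegral_eq_sum_cells hreg (fun K => ?_) fun K x hx => ?_
  · exact integrableOn_mul_cell (hf.mono_set (cell_subset hreg K)) (continuous_evalAt (w K).1)
  · exact congrArg (f x * ·) (pwFun_eq _ hx)

variable [NeZero d]

theorem skeletonForm_congr {s : Finset T.faces} {μ ν : Mh T k} (h : ∀ e ∈ s, μ e = ν e)
    (lam : Mh T k) : skeletonForm s lam μ = skeletonForm s lam ν := by
  simp only [skeletonForm_apply]
  exact Finset.sum_congr rfl fun e he => by rw [h e he]

theorem skeletonForm_eq_zero {s : Finset T.faces} {μ : Mh T k} (h : ∀ e ∈ s, μ e = 0)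
    (lam : Mh T k) : skeletonForm s lam μ = 0 := by
  rw [skeletonForm_congr (ν := 0) h, map_zero]

theorem skeletonForm_symm (s : Finset T.faces) (lam μ : Mh T k) :
    skeletonForm s lam μ = skeletonForm s μ lam := by
  simp only [skeletonForm_apply, mul_comm]

theorem IsHybridSolution.interiorTraceForm_eq_zero (h : IsHybridSolution T k κ f u₀ q u uhat)
    (μ : Mh T k) : interiorTraceForm q μ = 0 := by
  classical
  let μ' : Mh T k := (interiorFaces T).piecewise μ 0
  have hμ' : ∀ e ∈ interiorFaces T, μ' e = μ e := fun e he => Finset.piecewise_eq_of_mem _ _ _ he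
  rw [interiorTraceForm_eq, ← skeletonForm_symm, ← skeletonForm_congr hμ', skeletonForm_symm,
    ← interiorTraceForm_eq]
  exact h.continuity μ' fun e he => Finset.piecewise_eq_of_notMem _ _ _ (by simpa using he)

theorem IsHybridSolution.boundaryForm_eq_boundaryLoad (h : IsHybridSolution T k κ f u₀ q u uhat)
    (μ : Mh T k) : boundaryForm uhat μ = boundaryLoad u₀ μ := by
  classical
  let μ' : Mh T k := (boundaryFaces T).piecewise μ 0
  have hμ' : ∀ e ∈ boundaryFaces T, μ' e = μ e := fun e he => Finset.piecewise_eq_of_mem _ _ _ he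
  have hload : boundaryLoad u₀ μ' = boundaryLoad u₀ μ :=
    Finset.sum_congr rfl fun e he => by rw [hμ' e he]
  rw [boundaryForm_eq, ← skeletonForm_congr hμ', ← boundaryForm_eq, ← hload]
  exact h.dirichlet μ' fun e he => Finset.piecewise_eq_of_notMem _ _ _ (by simpa using he)

theorem mem_VhDiv_iff (hreg : interior (closure Ω) = Ω) :
    q ∈ VhDiv T k ↔ ∀ e ∈ interiorFaces T, faceJump q e = 0 := by
  simp only [mem_interiorFaces]
  refine (memHdiv_iff hreg).trans (forall_congr' fun e => forall_congr' fun _ => ?_)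
  rw [Subtype.ext_iff, funext_iff, Subtype.forall]
  rfl

theorem setIntegral_scalarFun_mul_weakDiv (hreg : interior (closure Ω) = Ω) (w : Wh T k)
    (hq : q ∈ VhDiv T k) :
    ∫ x in Ω, scalarFun w x * weakDiv Ω (vectorFun q) x = divForm w q := by
  trans ∫ x in Ω, scalarFun w x * pwDiv (fun K => (q K).1) x
  · exact integral_congr_ae ((weakDiv_ae_eq hreg hq).mono fun x hx =>
      congrArg (scalarFun w x * ·) hx)
  · refine setIntegral_eq_sum_cells hreg (fun K => integrableOn_cell ?_) fun K x hx => ?_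
    · exact (continuous_evalAt (w K).1).mul (continuous_evalAt (polyDiv (q K).1))
    · exact congrArg₂ (· * ·) (pwFun_eq _ hx) (pwFun_eq _ hx)

theorem isGalerkinSolution_iff (hreg : interior (closure Ω) = Ω)
    (hκ : IntegrableOn (fun x => (κ x)⁻¹) Ω) (hf : IntegrableOn f Ω) :
    IsGalerkinSolution T k κ f u₀ q u ↔ q ∈ VhDiv T k ∧
      (∀ r ∈ VhDiv T k, massForm κ q r - divForm u r = -boundaryFluxLoad u₀ r) ∧
      ∀ w, divForm w q = loadForm f w := by
  have hflux (r : Vh T k) (hr : r ∈ VhDiv T k) :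
      (∫ x in Ω, (κ x)⁻¹ * inner ℝ (vectorFun q x) (vectorFun r x)) -
        ∫ x in Ω, scalarFun u x * weakDiv Ω (vectorFun r) x =
      massForm κ q r - divForm u r := by
    rw [setIntegral_vectorFun hreg hκ, setIntegral_scalarFun_mul_weakDiv hreg u hr]
  have hbalance (hq : q ∈ VhDiv T k) (w : Wh T k) :
      ∫ x in Ω, weakDiv Ω (vectorFun q) x * scalarFun w x = divForm w q := by
    simp only [← setIntegral_scalarFun_mul_weakDiv hreg w hq, mul_comm]
  constructor
  · rintro ⟨hq, hfl, hbal⟩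
    refine ⟨hq, fun r hr => hflux r hr ▸ hfl r hr, fun w => ?_⟩
    rw [← hbalance hq, hbal, setIntegral_scalarFun hreg hf]
  · rintro ⟨hq, hfl, hbal⟩
    refine ⟨hq, fun r hr => (hflux r hr).trans (hfl r hr), fun w => ?_⟩
    rw [hbalance hq, hbal, setIntegral_scalarFun hreg hf]

theorem traceForm_eq_boundaryForm (hreg : interior (closure Ω) = Ω) (μ : Mh T k)
    (hr : r ∈ VhDiv T k) : traceForm μ r = boundaryForm μ (faceJump r) := by
  rw [traceForm_eq_add, interiorTraceForm_eq,
    skeletonForm_eq_zero ((mem_VhDiv_iff hreg).1 hr), zero_add]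

namespace IsHybridSolution

theorem mem_VhDiv (hreg : interior (closure Ω) = Ω)
    (h : IsHybridSolution T k κ f u₀ q u uhat) : q ∈ VhDiv T k := by
  have hjump := h.interiorTraceForm_eq_zero (faceJump q)
  rw [interiorTraceForm_eq] at hjump
  exact (mem_VhDiv_iff hreg).2 fun e => eq_zero_of_skeletonForm_self hjump

theorem traceForm_eq_boundaryFluxLoad (hreg : interior (closure Ω) = Ω)
    (hu₀ : IntegrableOn u₀ (frontier Ω) μHE[d - 1])
    (h : IsHybridSolution T k κ f u₀ q u uhat) (hr : r ∈ VhDiv T k) :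
    traceForm uhat r = boundaryFluxLoad u₀ r := by
  rw [traceForm_eq_boundaryForm hreg uhat hr, boundaryFluxLoad_eq hu₀]
  exact h.boundaryForm_eq_boundaryLoad (faceJump r)

theorem isGalerkinSolution (hreg : interior (closure Ω) = Ω)
    (hκ : IntegrableOn (fun x => (κ x)⁻¹) Ω) (hf : IntegrableOn f Ω)
    (hu₀ : IntegrableOn u₀ (frontier Ω) μHE[d - 1])
    (h : IsHybridSolution T k κ f u₀ q u uhat) : IsGalerkinSolution T k κ f u₀ q u := by
  refine (isGalerkinSolution_iff hreg hκ hf).2 ⟨h.mem_VhDiv hreg, fun r hr => ?_, h.balance⟩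
  rw [← h.traceForm_eq_boundaryFluxLoad hreg hu₀ hr]
  exact eq_neg_of_add_eq_zero_left (h.flux r)

end IsHybridSolution

end Systems

/-! ### The kernel of the local problem -/

section SimplexKernel

variable {d k : ℕ} {K : Finset (Space d)} {p : Poly d} {m : K → Poly d}

/-- The polynomial `p` on the simplex `K`, with boundary values `m a` on the face opposite to `a`,
has zero discrete gradient: it satisfies Green's formula against `RT_k` without the gradient. -/
def HasZeroWeakGradient (k : ℕ) (p : Poly d) (m : K → Poly d) : Prop :=
  ∀ ρ ∈ RT d k, ∫ x in hull K, evalAt x p * evalAt x (polyDiv ρ) =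
    ∑ a, ∫ x in hull (face K a), evalAt x (m a) * normalTrace K (face K a) ρ x ∂μHE[d - 1]

theorem evalAt_polyDiv_radialField (p : Poly d) (a x : Space d) :
    evalAt x (polyDiv (radialField p a)) =
      d * evalAt x p + fderiv ℝ (fun y => evalAt y p) x (x - a) := by
  have hd : evalAt x (d : Poly d) = d := map_natCast (MvPolynomial.aeval fun i => x i) d
  simp only [fderiv_evalAt, polyDiv, radialField, mulPosition, dirDeriv, Pi.sub_apply,
    LinearMap.pi_apply, LinearMap.mulLeft_apply, map_sub, map_sum, map_smul, Derivation.leibniz,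
    map_add, MvPolynomial.pderiv_X_self, smul_eq_mul, mul_one, evalAt_mul, evalAt_X,
    Finset.sum_sub_distrib, Finset.sum_add_distrib, Finset.sum_const,
    Finset.card_univ, Fintype.card_fin, nsmul_eq_mul, hd, Derivation.map_smul]
  ring

theorem vecEvalAt_sum {ι : Type*} [Fintype ι] (ρ : ι → Fin d → Poly d) (x : Space d) :
    vecEvalAt x (∑ i, ρ i) = ∑ i, vecEvalAt x (ρ i) := by
  ext j
  simp [vecEvalAt]

theorem continuous_fderiv_vecEvalAt (p : Poly d) (ρ : Fin d → Poly d) :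
    Continuous fun x => fderiv ℝ (fun y => evalAt y p) x (vecEvalAt x ρ) :=
  ((contDiff_evalAt p).continuous_fderiv (by simp)).clm_apply (continuous_vecEvalAt ρ)

theorem eqOn_zero_of_setIntegral_mul_eq_zero {U : Set (Space d)} {w g : Space d → ℝ}
    (hU : IsOpen U) (hw : ∀ᵐ x ∂volume.restrict U, 0 < w x) (hg : Continuous g)
    (hg0 : ∀ x ∈ U, 0 ≤ g x) (hgi : IntegrableOn (fun x => w x * g x) U)
    (h : ∫ x in U, w x * g x = 0) : EqOn g 0 U := by
  have hnonneg : ∀ᵐ x ∂volume.restrict U, 0 ≤ w x * g x := by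
    filter_upwards [hw, ae_restrict_mem hU.measurableSet] with x hx hxU
      using mul_nonneg hx.le (hg0 x hxU)
  have hzero := (integral_eq_zero_iff_of_nonneg_ae hnonneg hgi).1 h
  refine Measure.eqOn_open_of_ae_eq (μ := volume) ?_ hU hg.continuousOn continuousOn_const
  filter_upwards [hw, hzero] with x hx hwg using (mul_eq_zero.1 hwg).resolve_left hx.ne'

namespace IsSimplex

variable (hK : IsSimplex K)
include hK

theorem sum_coord_mul_fderiv_sub (p : Poly d) (x : Space d) :
    ∑ a, hK.coord a x * (fderiv ℝ (fun y => evalAt y p) x (-(a : Space d)) *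
        fderiv ℝ (fun y => evalAt y p) x (x - a)) =
      ∑ a, hK.coord a x * fderiv ℝ (fun y => evalAt y p) x (x - a) ^ 2 := by
  set D := fderiv ℝ (fun y => evalAt y p) x
  have hcentered : ∑ a, hK.coord a x * D (x - a) = 0 := by
    simp only [← smul_eq_mul, ← map_smul, ← map_sum, smul_sub, Finset.sum_sub_distrib,
      ← Finset.sum_smul, hK.sum_coord, hK.sum_coord_smul, one_smul, sub_self, map_zero]
  rw [← sub_eq_zero, ← Finset.sum_sub_distrib, ← neg_eq_zero, ← mul_zero (D x), ← hcentered,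
    Finset.mul_sum, ← Finset.sum_neg_distrib]
  refine Finset.sum_congr rfl fun a _ => ?_
  simp only [map_sub, map_neg]
  ring

variable [NeZero d]

theorem normalTrace_radialField (p : Poly d) (a b : K) {x : Space d} (hx : x ∈ hull (face K b)) :
    normalTrace K (face K b) (radialField p a) x =
      if b = a then height K a * evalAt x p else 0 := by
  rw [normalTrace, vecEvalAt_radialField, real_inner_smul_left]
  split_ifs with hab
  · subst hab
    rw [hK.inner_sub_vertex, hK.coord_eq_zero_of_mem_face hx]
    ring
  · have ha : (a : Space d) ∈ hull (face K b) :=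
      subset_convexHull ℝ _ (mem_face.2 ⟨fun h => hab (Subtype.ext h.symm), a.2⟩)
    rw [inner_sub_outwardNormal_of_mem_hull hx ha, mul_zero]

theorem integral_fderiv_vecEvalAt
    (h : HasZeroWeakGradient k p m) {ρ : Fin d → Poly d} (hρ : ρ ∈ RT d k) :
    ∫ x in hull K, fderiv ℝ (fun y => evalAt y p) x (vecEvalAt x ρ) =
      ∑ a, ∫ x in hull (face K a),
        evalAt x (p - m a) * normalTrace K (face K a) ρ x ∂μHE[d - 1] := by
  have hgrad := (continuous_fderiv_vecEvalAt p ρ).continuousOn.integrableOn_compact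
    (μ := volume) (isCompact_hull K)
  have hdiv : IntegrableOn (fun x => evalAt x p * evalAt x (polyDiv ρ)) (hull K) :=
    ((continuous_evalAt p).mul (continuous_evalAt (polyDiv ρ))).continuousOn.integrableOn_compact
      (isCompact_hull K)
  have hgreen := hK.integral_div ((contDiff_evalAt p).of_le (by norm_cast)) ρ
  rw [integral_add hgrad hdiv, h ρ hρ, ← eq_sub_iff_add_eq, ← Finset.sum_sub_distrib] at hgreen
  rw [hgreen]
  refine Finset.sum_congr rfl fun a _ => ?_
  have hgi (g : Poly d) : IntegrableOn (fun x => evalAt x g * normalTrace K (face K a) ρ x)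
      (hull (face K a)) μHE[d - 1] :=
    hK.integrableOn_face a ((continuous_evalAt g).mul (continuous_normalTrace K (face K a) ρ))
  rw [← integral_sub (hgi p) (hgi (m a))]
  simp only [map_sub, sub_mul]

/-- The field `∑ₐ λₐ (∂ₐp) (a - x)` has zero normal trace, since `λₐ = 0` on the face opposite to
`a` and `x - a` is tangential on the other faces. -/
theorem integral_sum_coord_mul_sq_eq_zero (hp : p ∈ Pk d k) (h : HasZeroWeakGradient k p m) :
    ∫ x in cell K, ∑ a, hK.coord a x * fderiv ℝ (fun y => evalAt y p) x (x - a) ^ 2 = 0 := by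
  let s (a : K) : Poly d := affinePoly (hK.coord a) * dirDeriv (-(a : Space d)) p
  have hs (a : K) : s a ∈ Pk d k := mul_dirDeriv_mem_Pk hp (totalDegree_affinePoly_le _) _
  have heval (a : K) (x : Space d) : evalAt x (s a) =
      hK.coord a x * fderiv ℝ (fun y => evalAt y p) x (-(a : Space d)) := by
    rw [evalAt_mul, evalAt_affinePoly, fderiv_evalAt]
  have hgreen := hK.integral_fderiv_vecEvalAt h
    (sum_mem (t := Finset.univ) fun a _ => radialField_mem_RT (hs a) a)
  simp only [vecEvalAt_sum, vecEvalAt_radialField, map_sum, map_smul, smul_eq_mul, heval,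
    mul_assoc, hK.sum_coord_mul_fderiv_sub] at hgreen
  rw [setIntegral_congr_set (cell_ae_eq_hull K), hgreen]
  refine Finset.sum_eq_zero fun b _ => setIntegral_eq_zero_of_forall_eq_zero fun x hx => ?_
  rw [normalTrace, vecEvalAt_sum, sum_inner, Finset.sum_eq_zero, mul_zero]
  intro a _
  rw [← normalTrace, hK.normalTrace_radialField (s a) a b hx]
  split_ifs with hab
  · rw [heval, ← hab, hK.coord_eq_zero_of_mem_face hx, zero_mul, mul_zero]
  · rfl

theorem fderiv_sub_vertex_eq_zero (hp : p ∈ Pk d k) (h : HasZeroWeakGradient k p m)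
    {x : Space d} (hx : x ∈ cell K) (a : K) :
    fderiv ℝ (fun y => evalAt y p) x (x - a) = 0 := by
  let g (x : Space d) : ℝ := ∑ a, hK.coord a x * fderiv ℝ (fun y => evalAt y p) x (x - a) ^ 2
  have hg : Continuous g := continuous_finsetSum _ fun a _ =>
    (hK.coord a).continuous_of_finiteDimensional.mul
      ((((contDiff_evalAt p).continuous_fderiv (by simp)).clm_apply (by fun_prop)).pow 2)
  have hnonneg {x : Space d} (hx : x ∈ cell K) (a : K) :
      0 ≤ hK.coord a x * fderiv ℝ (fun y => evalAt y p) x (x - a) ^ 2 :=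
    mul_nonneg (hK.mem_cell_iff.1 hx a).le (sq_nonneg _)
  have hzero : g x = 0 := eqOn_zero_of_setIntegral_mul_eq_zero (w := 1) (isOpen_cell K)
    (.of_forall fun _ => one_pos) hg (fun x hx => Finset.sum_nonneg fun a _ => hnonneg hx a)
    (by simpa only [Pi.one_apply, one_mul] using integrableOn_cell hg)
    (by simpa only [Pi.one_apply, one_mul] using hK.integral_sum_coord_mul_sq_eq_zero hp h) hx
  have hterm := (Finset.sum_eq_zero_iff_of_nonneg fun a _ => hnonneg hx a).1 hzero a
    (Finset.mem_univ a)
  exact sq_eq_zero_iff.1 ((mul_eq_zero.1 hterm).resolve_left (hK.mem_cell_iff.1 hx a).ne')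

theorem fderiv_eq_zero (hp : p ∈ Pk d k) (h : HasZeroWeakGradient k p m) {x : Space d}
    (hx : x ∈ cell K) : fderiv ℝ (fun y => evalAt y p) x = 0 := by
  have hzero (a : K) : fderiv ℝ (fun y => evalAt y p) x (x - a) = 0 :=
    hK.fderiv_sub_vertex_eq_zero hp h hx a
  ext v
  have hv : v = -∑ a, (hK.coord a).linear v • (x - a) := by
    simp only [smul_sub, Finset.sum_sub_distrib, ← Finset.sum_smul, hK.sum_linear_coord,
      hK.sum_linear_coord_smul, zero_smul, zero_sub, neg_neg]
  rw [hv]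
  simp [-map_sub, hzero]

theorem evalAt_eq_of_mem_face (hp : p ∈ Pk d k) (hm : ∀ a, m a ∈ Pk d k)
    (h : HasZeroWeakGradient k p m) {a : K} {x : Space d} (hx : x ∈ hull (face K a)) :
    evalAt x p = evalAt x (m a) := by
  have hgreen := hK.integral_fderiv_vecEvalAt h
    (radialField_mem_RT (sub_mem hp (hm a)) (a : Space d))
  have hgrad : ∫ x in hull K, fderiv ℝ (fun y => evalAt y p) x
      (vecEvalAt x (radialField (p - m a) a)) = 0 := by
    rw [← setIntegral_congr_set (cell_ae_eq_hull K)]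
    exact setIntegral_eq_zero_of_forall_eq_zero fun x hx => by
      rw [hK.fderiv_eq_zero hp h hx, zero_apply]
  have hface (b : K) : ∫ x in hull (face K b), evalAt x (p - m b) *
        normalTrace K (face K b) (radialField (p - m a) a) x ∂μHE[d - 1] =
      if b = a then height K a * ∫ x in hull (face K a), evalAt x (p - m a) ^ 2 ∂μHE[d - 1]
      else 0 := by
    rw [setIntegral_congr_fun (isClosed_hull _).measurableSet fun x hx =>
      congrArg (evalAt x (p - m b) * ·) (hK.normalTrace_radialField (p - m a) a b hx)]
    split_ifs with hab
    · simp only [hab, ← integral_const_mul, pow_two, mul_left_comm]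
    · simp
  simp only [hgrad, hface, Finset.sum_ite_eq', Finset.mem_univ, if_true] at hgreen
  rw [← sub_eq_zero, ← map_sub, ← sq_eq_zero_iff]
  exact hK.eq_zero_of_integral_face_eq_zero a ((continuous_evalAt _).pow 2)
    (fun y _ => sq_nonneg _) ((mul_eq_zero.1 hgreen.symm).resolve_left (hK.height_pos a).ne') hx

end IsSimplex

end SimplexKernel

/-! ### Unique solvability -/

section Uniqueness

variable {d k : ℕ} {Ω : Set (Space d)} {T : Triangulation Ω} {κ : Space d → ℝ}
  {q : Vh T k} {u : Wh T k} {uhat : Mh T k}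

theorem evalAt_eq_zero_of_eqOn_cell {K : T.elems} {p : Poly d}
    (h : ∀ x ∈ cell K.1, evalAt x p = 0) : p = 0 :=
  eq_zero_of_evalAt_eq_zero (isOpen_cell K.1) ⟨_, (isSimplex_elem K).barycenter_mem_cell⟩ h

theorem eq_zero_of_massForm_self (hreg : interior (closure Ω) = Ω)
    (hκ : IntegrableOn (fun x => (κ x)⁻¹) Ω) (hpos : ∀ᵐ x ∂volume.restrict Ω, 0 < κ x)
    (h : massForm κ q q = 0) : q = 0 := by
  have hw (K : T.elems) : ∀ᵐ x ∂volume.restrict (cell K.1), 0 < (κ x)⁻¹ :=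
    ae_restrict_of_ae_restrict_of_subset (cell_subset hreg K) (hpos.mono fun x => inv_pos.2)
  have hsq (K : T.elems) :
      Continuous fun x => inner ℝ (vecEvalAt x (q K).1) (vecEvalAt x (q K).1) :=
    (continuous_vecEvalAt _).inner (continuous_vecEvalAt _)
  have hzero := (Finset.sum_eq_zero_iff_of_nonneg fun K _ => integral_nonneg_of_ae
    ((hw K).mono fun x hx => mul_nonneg hx.le real_inner_self_nonneg)).1 h
  refine funext fun K => Subtype.ext <| funext fun i => evalAt_eq_zero_of_eqOn_cell (K := K)
    fun x hx => ?_
  have hx' := eqOn_zero_of_setIntegral_mul_eq_zero (isOpen_cell K.1) (hw K) (hsq K)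
    (fun _ _ => real_inner_self_nonneg)
    (integrableOn_mul_cell (hκ.mono_set (cell_subset hreg K)) (hsq K))
    (hzero K (Finset.mem_univ K)) hx
  exact congrArg (· i) (inner_self_eq_zero.1 hx')

theorem loadForm_scalarFun (w : Wh T k) :
    loadForm (scalarFun w) w = ∑ K : T.elems, ∫ x in cell K.1, evalAt x (w K).1 ^ 2 :=
  Finset.sum_congr rfl fun K _ => setIntegral_congr_fun (isOpen_cell K.1).measurableSet
    fun x hx => (congrArg (· * evalAt x (w K).1) (pwFun_eq _ hx)).trans (sq _).symm

theorem eq_zero_of_loadForm_scalarFun (h : loadForm (scalarFun u) u = 0) : u = 0 := by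
  rw [loadForm_scalarFun, Finset.sum_eq_zero_iff_of_nonneg fun K _ =>
    integral_nonneg fun x => sq_nonneg _] at h
  refine funext fun K => Subtype.ext <| evalAt_eq_zero_of_eqOn_cell (K := K) fun x hx => ?_
  have hsq : Continuous fun x => evalAt x (u K).1 ^ 2 := (continuous_evalAt _).pow 2
  exact sq_eq_zero_iff.1 <| eqOn_zero_of_setIntegral_mul_eq_zero (w := 1) (isOpen_cell K.1)
    (.of_forall fun _ => one_pos) hsq (fun _ _ => sq_nonneg _)
    (by simpa only [Pi.one_apply, one_mul] using integrableOn_cell hsq)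
    (by simpa only [Pi.one_apply, one_mul] using h K (Finset.mem_univ K)) hx

theorem divForm_single (w : Wh T k) (K : T.elems) (ρ : RT d k) :
    divForm w (Pi.single K ρ) =
      ∫ x in cell K.1, evalAt x (w K).1 * evalAt x (polyDiv ρ.1) := by
  rw [divForm, Fintype.sum_eq_single K, Pi.single_eq_same]
  intro L hL
  simp [Pi.single_eq_of_ne hL, polyDiv]

theorem traceForm_single (μ : Mh T k) (K : T.elems) (ρ : RT d k) :
    traceForm μ (Pi.single K ρ) = ∑ e : T.faces with e.1 ⊆ K.1,
      faceIntegral e.1 fun x => (μ e).1 x * normalTrace K.1 e.1 ρ.1 x := by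
  rw [traceForm, Fintype.sum_eq_single K, Pi.single_eq_same]
  intro L hL
  simp [Pi.single_eq_of_ne hL, normalTrace, inner_vecEvalAt, faceIntegral]

theorem exists_hasZeroWeakGradient (h : ∀ r : Vh T k, divForm u r = traceForm uhat r)
    (K : T.elems) : ∃ m : K.1 → Poly d, (∀ a, m a ∈ Pk d k) ∧
      (∀ a (x : hull (face K.1 a)),
        evalAt (x : Space d) (m a) = (uhat ⟨face K.1 a, face_mem_faces K a⟩).1 x) ∧
      HasZeroWeakGradient k (u K).1 m := by
  choose m hm heval using fun a : K.1 =>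
    exists_evalAt_eq_of_mem_facePk (uhat ⟨face K.1 a, face_mem_faces K a⟩).2
  refine ⟨m, hm, fun a x => (heval a x).symm, fun ρ hρ => ?_⟩
  have htest := h (Pi.single K ⟨ρ, hρ⟩)
  rw [divForm_single, traceForm_single, setIntegral_congr_set (cell_ae_eq_hull K.1),
    sum_faces K fun e => faceIntegral e.1 fun x => (uhat e).1 x * normalTrace K.1 e.1 ρ x] at htest
  rw [htest]
  refine Finset.sum_congr rfl fun a _ => ?_
  simp only [heval]
  exact faceIntegral_eq _ fun x => evalAt x (m a) * normalTrace K.1 (face K.1 a) ρ x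

theorem integral_fderiv_const_eq_zero {φ : Space d → ℝ} (hφ : ContDiff ℝ 1 φ)
    (hcomp : HasCompactSupport φ) (hsupp : tsupport φ ⊆ Ω) (v : Space d) :
    ∫ x in Ω, fderiv ℝ φ x v = 0 := by
  rw [setIntegral_eq_integral_of_forall_compl_eq_zero fun x hx => by
    rw [image_eq_zero_of_notMem_tsupport fun h => hx (hsupp (tsupport_fderiv_subset ℝ h)),
      zero_apply]]
  have hderiv : Integrable fun x => fderiv ℝ φ x v :=
    ((hφ.continuous_fderiv (by simp)).clm_apply continuous_const).integrable_of_hasCompactSupport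
      (hcomp.fderiv_apply ℝ v)
  simpa using integral_mul_fderiv_eq_neg_fderiv_mul_of_integrable (μ := volume)
    (f := fun _ : Space d => (1 : ℝ)) (g := φ) (v := v) (by simp) (by simpa using hderiv)
    (by simpa using hφ.continuous.integrable_of_hasCompactSupport hcomp)
    (fun _ _ => differentiableAt_const _) (fun x _ => hφ.differentiable (by simp) x)

variable [NeZero d]

theorem fderiv_eq_zero_of_divForm_eq_traceForm
    (h : ∀ r : Vh T k, divForm u r = traceForm uhat r) {K : T.elems} {x : Space d}
    (hx : x ∈ cell K.1) : fderiv ℝ (fun y => evalAt y (u K).1) x = 0 := by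
  obtain ⟨m, -, -, hgrad⟩ := exists_hasZeroWeakGradient h K
  exact (isSimplex_elem K).fderiv_eq_zero (u K).2 hgrad hx

theorem evalAt_eq_of_divForm_eq_traceForm
    (h : ∀ r : Vh T k, divForm u r = traceForm uhat r) {K : T.elems} {e : T.faces}
    (he : e.1 ⊆ K.1) (x : hull e.1) : evalAt (x : Space d) (u K).1 = (uhat e).1 x := by
  obtain ⟨m, hm, heval, hgrad⟩ := exists_hasZeroWeakGradient h K
  obtain ⟨e, hface⟩ := e
  obtain ⟨a, rfl⟩ := exists_face_eq_of_subset (e := ⟨e, hface⟩) he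
  rw [(isSimplex_elem K).evalAt_eq_of_mem_face (u K).2 hm hgrad x.2, heval]

/-- A constant field is solenoidal, so its normal component does not jump. -/
theorem sum_outwardNormal_eq_zero (hreg : interior (closure Ω) = Ω) {e : T.faces}
    (he : e ∈ interiorFaces T) : ∑ K : T.elems with e.1 ⊆ K.1, outwardNormal K.1 e.1 = 0 := by
  refine ext_inner_left ℝ fun v => ?_
  let q : T.elems → Fin d → Poly d := fun _ i => MvPolynomial.C (v i)
  have heval (x : Space d) : vecEvalAt x (fun i => MvPolynomial.C (v i)) = v := by
    ext i
    simp [vecEvalAt]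
  have hdiv : HasWeakDiv Ω (pwField q) 0 := fun φ hφ hcomp hsupp => by
    have hconst : ∀ᵐ x ∂volume.restrict Ω, pwField q x = v := by
      rw [← Measure.restrict_congr_set (iUnion_cell_ae_eq (T := T) hreg),
        ae_restrict_iff' (isOpen_iUnion fun K : T.elems => isOpen_cell K.1).measurableSet]
      refine .of_forall fun x hx => ?_
      obtain ⟨K, hxK⟩ := mem_iUnion.1 hx
      exact (pwFun_eq _ hxK).trans (heval x)
    simp only [Pi.zero_apply, zero_mul, integral_zero, neg_zero]
    rw [← integral_fderiv_const_eq_zero (hφ.of_le (by norm_cast)) hcomp hsupp v]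
    exact integral_congr_ae (hconst.mono fun x hx => by simp only [hx])
  obtain ⟨x, hx⟩ : (hull e.1).Nonempty :=
    (Finset.coe_nonempty.2 (nonempty_of_mem_faces e)).convexHull
  have hjump := normalJump_eq_zero hreg (integrable_zero _ _ _) hdiv e (mem_interiorFaces.1 he) hx
  simpa [normalJump, normalTrace, q, heval, inner_sum] using hjump

theorem radialField_mem_VhDiv (hreg : interior (closure Ω) = Ω)
    (h : ∀ r : Vh T k, divForm u r = traceForm uhat r) :
    (fun K => ⟨radialField (u K).1 0, radialField_mem_RT (u K).2 0⟩ : Vh T k) ∈ VhDiv T k := by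
  refine (mem_VhDiv_iff hreg).2 fun e he => Subtype.ext <| funext fun x => ?_
  calc normalJump (fun K => radialField (u K).1 0) e.1 x
      = ∑ K : T.elems with e.1 ⊆ K.1,
          (uhat e).1 x * inner ℝ (x : Space d) (outwardNormal K.1 e.1) := by
        refine Finset.sum_congr rfl fun K hK => ?_
        rw [normalTrace, vecEvalAt_radialField, sub_zero, real_inner_smul_left,
          evalAt_eq_of_divForm_eq_traceForm h (Finset.mem_filter.1 hK).2]
    _ = 0 := by
        rw [← Finset.mul_sum, ← inner_sum, sum_outwardNormal_eq_zero hreg he, inner_zero_right,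
          mul_zero]

/-- Test with the field `u x`: it is conforming because `û` is the common trace of `u`, and its
divergence is `d u` because `u` is piecewise constant. -/
theorem eq_zero_of_divForm_eq_traceForm (hreg : interior (closure Ω) = Ω)
    (h : ∀ r : Vh T k, divForm u r = traceForm uhat r)
    (hb : ∀ e ∈ boundaryFaces T, uhat e = 0) : u = 0 := by
  let r : Vh T k := fun K => ⟨radialField (u K).1 0, radialField_mem_RT (u K).2 0⟩
  have htrace : traceForm uhat r = 0 := by
    rw [traceForm_eq_boundaryForm hreg uhat (radialField_mem_VhDiv hreg h), boundaryForm_eq,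
      skeletonForm_symm, skeletonForm_eq_zero hb]
  have hdiv : divForm u r = d * loadForm (scalarFun u) u := by
    rw [loadForm_scalarFun, divForm, Finset.mul_sum]
    refine Finset.sum_congr rfl fun K _ => ?_
    rw [← integral_const_mul]
    refine setIntegral_congr_fun (isOpen_cell K.1).measurableSet fun x hx => ?_
    simp only [r, evalAt_polyDiv_radialField, fderiv_eq_zero_of_divForm_eq_traceForm h hx,
      zero_apply]
    ring
  refine eq_zero_of_loadForm_scalarFun ((mul_eq_zero.1 ?_).resolve_left (NeZero.ne (d : ℝ)))
  rw [← hdiv, h, htrace]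

theorem trace_eq_zero_of_divForm_eq_traceForm (hreg : interior (closure Ω) = Ω)
    (h : ∀ r : Vh T k, divForm u r = traceForm uhat r)
    (hb : ∀ e ∈ boundaryFaces T, uhat e = 0) : uhat = 0 := by
  have hu := eq_zero_of_divForm_eq_traceForm hreg h hb
  ext e x
  obtain ⟨K, a, he⟩ := exists_face_eq e
  rw [← evalAt_eq_of_divForm_eq_traceForm h (he ▸ face_subset a) x, hu]
  simp

end Uniqueness

section FiniteDimensional

variable {d : ℕ}

instance finiteDimensional_Pk (d k : ℕ) : FiniteDimensional ℝ (Pk d k) :=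
  inferInstanceAs (FiniteDimensional ℝ (MvPolynomial.restrictTotalDegree (Fin d) ℝ k))

instance finiteDimensional_facePk (k : ℕ) (e : Finset (Space d)) :
    FiniteDimensional ℝ (facePk k e) := by
  unfold facePk
  infer_instance

instance finiteDimensional_RT (d k : ℕ) : FiniteDimensional ℝ (RT d k) := by
  have : FiniteDimensional ℝ (MvPolynomial.homogeneousSubmodule (Fin d) ℝ k) :=
    Submodule.finiteDimensional_of_le (S₂ := Pk d k) fun p hp => mem_Pk.2
      ((MvPolynomial.mem_homogeneousSubmodule _ _).1 hp).totalDegree_le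
  exact .of_fg ((Submodule.fg_pi fun _ => .of_finite).sup (Submodule.FG.of_finite.map _))

end FiniteDimensional

section Solvability

variable {d k : ℕ} {Ω : Set (Space d)} {T : Triangulation Ω} {κ f u₀ : Space d → ℝ}
  {q q' : Vh T k} {u u' : Wh T k} {uhat : Mh T k}

/-- The sum of the right-hand sides of the hybridized system. -/
def hybridLoad (hf : ∀ K : T.elems, IntegrableOn f (cell K.1))
    (hu₀ : IntegrableOn u₀ (frontier Ω) μHE[d - 1]) :
    Module.Dual ℝ (Vh T k × Wh T k × Mh T k) :=
  (0 : Vh T k →ₗ[ℝ] ℝ).coprod ((loadFunctional hf).coprod (boundaryLoadFunctional hu₀))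

theorem hybridLoad_apply (hf : ∀ K : T.elems, IntegrableOn f (cell K.1))
    (hu₀ : IntegrableOn u₀ (frontier Ω) μHE[d - 1]) (t : Vh T k × Wh T k × Mh T k) :
    hybridLoad hf hu₀ t = loadForm f t.2.1 + boundaryLoad u₀ t.2.2 := by
  simp [hybridLoad, loadFunctional_apply, boundaryLoadFunctional_apply]

theorem boundaryLoad_eq_zero_of_mem_MhInterior {μ : Mh T k} (hμ : μ ∈ MhInterior T k) :
    boundaryLoad u₀ μ = 0 := by
  classical
  exact Finset.sum_eq_zero fun e he => by simp [hμ e (Finset.mem_filter.1 he).2, faceIntegral]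

variable [NeZero d]

/-- The bilinear form of the hybridized system, the sum of its four left-hand sides. -/
def hybridForm (hκ : ∀ K : T.elems, IntegrableOn (fun x => (κ x)⁻¹) (cell K.1)) :
    (Vh T k × Wh T k × Mh T k) →ₗ[ℝ] Module.Dual ℝ (Vh T k × Wh T k × Mh T k) :=
  let πq := LinearMap.fst ℝ (Vh T k) (Wh T k × Mh T k)
  let πu := LinearMap.fst ℝ (Wh T k) (Mh T k) ∘ₗ LinearMap.snd ℝ (Vh T k) (Wh T k × Mh T k)
  let πhat := LinearMap.snd ℝ (Wh T k) (Mh T k) ∘ₗ LinearMap.snd ℝ (Vh T k) (Wh T k × Mh T k)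
  (massBilin hκ).compl₁₂ πq πq - (divBilin T k).compl₁₂ πu πq +
    (skeletonForm Finset.univ).compl₁₂ πhat (faceJump ∘ₗ πq) +
    (divBilin T k).flip.compl₁₂ πq πu +
    (skeletonForm (interiorFaces T)).flip.compl₁₂ (faceJump ∘ₗ πq) πhat +
    (skeletonForm (boundaryFaces T)).compl₁₂ πhat πhat

theorem hybridForm_apply (hκ : ∀ K : T.elems, IntegrableOn (fun x => (κ x)⁻¹) (cell K.1))
    (s t : Vh T k × Wh T k × Mh T k) :
    hybridForm hκ s t = massForm κ s.1 t.1 - divForm s.2.1 t.1 + traceForm s.2.2 t.1 +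
      divForm t.2.1 s.1 + interiorTraceForm s.1 t.2.2 + boundaryForm s.2.2 t.2.2 := by
  simp only [← massBilin_apply hκ, ← divBilin_apply, traceForm_eq, interiorTraceForm_eq,
    boundaryForm_eq]
  rfl

theorem boundaryForm_eq_zero_of_mem_MhInterior {μ : Mh T k} (hμ : μ ∈ MhInterior T k) :
    boundaryForm uhat μ = 0 := by
  rw [boundaryForm_eq]
  exact skeletonForm_eq_zero (fun e he => hμ e (mem_boundaryFaces.1 he)) uhat

theorem interiorTraceForm_eq_zero_of_mem_MhBoundary {μ : Mh T k} (hμ : μ ∈ MhBoundary T k) :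
    interiorTraceForm q μ = 0 := by
  rw [interiorTraceForm_eq, skeletonForm_symm]
  exact skeletonForm_eq_zero (fun e he => hμ e (mem_interiorFaces.1 he)) _

theorem isHybridSolution_iff (hκ : ∀ K : T.elems, IntegrableOn (fun x => (κ x)⁻¹) (cell K.1))
    (hf : ∀ K : T.elems, IntegrableOn f (cell K.1))
    (hu₀ : IntegrableOn u₀ (frontier Ω) μHE[d - 1]) :
    IsHybridSolution T k κ f u₀ q u uhat ↔ hybridForm hκ (q, u, uhat) = hybridLoad hf hu₀ := by
  refine ⟨fun h => LinearMap.ext fun t => ?_, fun h => ?_⟩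
  · rw [hybridForm_apply, hybridLoad_apply, h.flux, h.balance, h.interiorTraceForm_eq_zero,
      h.boundaryForm_eq_boundaryLoad]
    ring
  · have htest (t : Vh T k × Wh T k × Mh T k) := DFunLike.congr_fun h t
    simp only [hybridForm_apply, hybridLoad_apply] at htest
    have hzero (q : Vh T k) : divForm 0 q = 0 := by simp [← divBilin_apply]
    refine ⟨fun r => ?_, fun w => ?_, fun μ hμ => ?_, fun μ hμ => ?_⟩
    · simpa [hzero, interiorTraceForm_eq, boundaryForm_eq, ← loadFunctional_apply hf,
        ← boundaryLoadFunctional_apply hu₀] using htest (r, 0, 0)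
    · simpa [← massBilin_apply hκ, ← divBilin_apply, traceForm_eq, interiorTraceForm_eq,
        boundaryForm_eq, ← boundaryLoadFunctional_apply hu₀] using htest (0, w, 0)
    · simpa [← massBilin_apply hκ, ← divBilin_apply, traceForm_eq, ← loadFunctional_apply hf,
        boundaryForm_eq_zero_of_mem_MhInterior hμ, boundaryLoad_eq_zero_of_mem_MhInterior hμ]
        using htest (0, 0, μ)
    · simpa [← massBilin_apply hκ, ← divBilin_apply, traceForm_eq, ← loadFunctional_apply hf,
        interiorTraceForm_eq_zero_of_mem_MhBoundary hμ] using htest (0, 0, μ)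

namespace IsHybridSolution

theorem eq_zero (hreg : interior (closure Ω) = Ω) (hκ : IntegrableOn (fun x => (κ x)⁻¹) Ω)
    (hpos : ∀ᵐ x ∂volume.restrict Ω, 0 < κ x) (h : IsHybridSolution T k κ 0 0 q u uhat) :
    (q, u, uhat) = 0 := by
  have hload (w : Wh T k) : loadForm 0 w = 0 := by simp [loadForm]
  have hboundary : ∀ e ∈ boundaryFaces T, uhat e = 0 := fun e =>
    eq_zero_of_skeletonForm_self <| by
      rw [← boundaryForm_eq, h.boundaryForm_eq_boundaryLoad]
      simp [boundaryLoad, faceIntegral]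
  have htrace : traceForm uhat q = 0 := by
    rw [traceForm_eq_boundaryForm hreg uhat (h.mem_VhDiv hreg), boundaryForm_eq,
      skeletonForm_symm, skeletonForm_eq_zero hboundary]
  have hmass : massForm κ q q = 0 := by
    have := h.flux q
    rwa [h.balance, hload, htrace, sub_zero, add_zero] at this
  have hq : q = 0 := eq_zero_of_massForm_self hreg hκ hpos hmass
  have hgrad (r : Vh T k) : divForm u r = traceForm uhat r := by
    have hmass_zero : massForm κ 0 r = 0 := by
      rw [← massBilin_apply fun K => hκ.mono_set (cell_subset hreg K), map_zero,
        LinearMap.zero_apply]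
    have := h.flux r
    rw [hq, hmass_zero] at this
    linarith
  rw [hq, eq_zero_of_divForm_eq_traceForm hreg hgrad hboundary,
    trace_eq_zero_of_divForm_eq_traceForm hreg hgrad hboundary]
  rfl

end IsHybridSolution

/-- The system is square, so uniqueness implies existence. -/
theorem existsUnique_isHybridSolution (hreg : interior (closure Ω) = Ω)
    (hκ : IntegrableOn (fun x => (κ x)⁻¹) Ω) (hpos : ∀ᵐ x ∂volume.restrict Ω, 0 < κ x)
    (hf : IntegrableOn f Ω) (hu₀ : IntegrableOn u₀ (frontier Ω) μHE[d - 1]) :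
    ∃! s : Vh T k × Wh T k × Mh T k, IsHybridSolution T k κ f u₀ s.1 s.2.1 s.2.2 := by
  have hκ' (K : T.elems) := hκ.mono_set (cell_subset hreg K)
  have hf' (K : T.elems) := hf.mono_set (cell_subset hreg K)
  have hinj : Function.Injective (hybridForm (k := k) hκ') := by
    refine (injective_iff_map_eq_zero _).2 fun s hs => ?_
    refine IsHybridSolution.eq_zero hreg hκ hpos ((isHybridSolution_iff hκ'
      (fun K => integrableOn_zero) integrableOn_zero).2 (hs.trans ?_))
    exact LinearMap.ext fun t => by simp [hybridLoad_apply, loadForm, boundaryLoad, faceIntegral]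
  have hsurj : Function.Surjective (hybridForm (k := k) hκ') :=
    (LinearMap.injective_iff_surjective_of_finrank_eq_finrank
      Subspace.dual_finrank_eq.symm).1 hinj
  simp only [isHybridSolution_iff hκ' hf' hu₀]
  exact Function.Bijective.existsUnique ⟨hinj, hsurj⟩ (hybridLoad hf' hu₀)

theorem exists_mem_VhDiv_divForm_eq (hreg : interior (closure Ω) = Ω) (hf : IntegrableOn f Ω) :
    ∃ r ∈ VhDiv T k, ∀ w : Wh T k, divForm w r = loadForm f w := by
  have := isFiniteMeasure_restrict_domain T
  have hone : IntegrableOn (fun x => ((1 : Space d → ℝ) x)⁻¹) Ω := integrable_const (1 : ℝ)⁻¹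
  obtain ⟨⟨r, u, uhat⟩, h, -⟩ := existsUnique_isHybridSolution (T := T) (k := k) (u₀ := 0)
    hreg hone (.of_forall fun _ => one_pos) hf integrableOn_zero
  exact ⟨r, h.mem_VhDiv hreg, h.balance⟩

theorem eq_zero_of_divForm_eq_zero (hreg : interior (closure Ω) = Ω)
    (h : ∀ r ∈ VhDiv T k, divForm u r = 0) : u = 0 := by
  have hu : IntegrableOn (scalarFun u) Ω :=
    memLp_one_iff_integrable.1 (memLp_pwFun (fun K => continuous_evalAt (u K).1) 1)
  obtain ⟨r, hr, hdiv⟩ := exists_mem_VhDiv_divForm_eq (T := T) (k := k) hreg hu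
  exact eq_zero_of_loadForm_scalarFun ((hdiv u).symm.trans (h r hr))

theorem sub_mem_VhDiv (hreg : interior (closure Ω) = Ω) (hq : q ∈ VhDiv T k)
    (hq' : q' ∈ VhDiv T k) : q - q' ∈ VhDiv T k := by
  rw [mem_VhDiv_iff hreg] at *
  exact fun e he => by rw [map_sub, Pi.sub_apply, hq e he, hq' e he, sub_zero]

namespace IsGalerkinSolution

theorem unique (hreg : interior (closure Ω) = Ω) (hκ : IntegrableOn (fun x => (κ x)⁻¹) Ω)
    (hpos : ∀ᵐ x ∂volume.restrict Ω, 0 < κ x) (hf : IntegrableOn f Ω)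
    (h : IsGalerkinSolution T k κ f u₀ q u) (h' : IsGalerkinSolution T k κ f u₀ q' u') :
    q = q' ∧ u = u' := by
  obtain ⟨hq, hflux, hbal⟩ := (isGalerkinSolution_iff hreg hκ hf).1 h
  obtain ⟨hq', hflux', hbal'⟩ := (isGalerkinSolution_iff hreg hκ hf).1 h'
  have hκ' (K : T.elems) := hκ.mono_set (cell_subset hreg K)
  have hdiv (r : Vh T k) (hr : r ∈ VhDiv T k) :
      massForm κ (q - q') r = divForm (u - u') r := by
    have hr' := (hflux r hr).trans (hflux' r hr).symm
    simp only [← massBilin_apply hκ', ← divBilin_apply, map_sub, LinearMap.sub_apply] at hr' ⊢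
    linarith
  have hq_eq : q - q' = 0 := by
    refine eq_zero_of_massForm_self hreg hκ hpos ?_
    rw [hdiv _ (sub_mem_VhDiv hreg hq hq'), ← divBilin_apply, map_sub, divBilin_apply,
      divBilin_apply, hbal, hbal', sub_self]
  have hu_eq : u - u' = 0 := eq_zero_of_divForm_eq_zero hreg fun r hr => by
    rw [← hdiv r hr, hq_eq, ← massBilin_apply hκ', map_zero, LinearMap.zero_apply]
  exact ⟨sub_eq_zero.1 hq_eq, sub_eq_zero.1 hu_eq⟩

theorem exists_isHybridSolution (hreg : interior (closure Ω) = Ω)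
    (hκ : IntegrableOn (fun x => (κ x)⁻¹) Ω) (hpos : ∀ᵐ x ∂volume.restrict Ω, 0 < κ x)
    (hf : IntegrableOn f Ω) (hu₀ : IntegrableOn u₀ (frontier Ω) μHE[d - 1])
    (h : IsGalerkinSolution T k κ f u₀ q u) :
    ∃ uhat : Mh T k, IsHybridSolution T k κ f u₀ q u uhat := by
  obtain ⟨⟨q', u', uhat⟩, hs, -⟩ :=
    existsUnique_isHybridSolution (T := T) (k := k) hreg hκ hpos hf hu₀
  obtain ⟨rfl, rfl⟩ := h.unique hreg hκ hpos hf (hs.isGalerkinSolution hreg hκ hf hu₀)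
  exact ⟨uhat, hs⟩

end IsGalerkinSolution

end Solvability

section Integrability

variable {d : ℕ} {Ω : Set (Space d)} {κ : Space d → ℝ}

theorem integrableOn_inv_of_le (T : Triangulation Ω)
    (hκ : AEStronglyMeasurable κ (volume.restrict Ω)) {κ₀ : ℝ} (hκ₀ : 0 < κ₀)
    (hle : ∀ᵐ x ∂volume.restrict Ω, κ₀ ≤ κ x) : IntegrableOn (fun x => (κ x)⁻¹) Ω := by
  have := isFiniteMeasure_restrict_domain T
  refine Integrable.of_bound hκ.aemeasurable.inv.aestronglyMeasurable κ₀⁻¹ (hle.mono fun x hx => ?_)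
  rw [Real.norm_of_nonneg (inv_nonneg.2 (hκ₀.le.trans hx))]
  exact inv_anti₀ hκ₀ hx

theorem frontier_subset_iUnion_hull (T : Triangulation Ω) (hreg : interior (closure Ω) = Ω) :
    frontier Ω ⊆ ⋃ e : T.faces, hull e.1 := by
  intro x hx
  obtain ⟨K, hK, hxK⟩ := mem_iUnion₂.1 (T.cover ▸ hx.1 : x ∈ ⋃ K ∈ T.elems, hull K)
  have hsimplex := isSimplex_elem ⟨K, hK⟩
  have hcell : x ∉ cell K := fun h =>
    hx.2 ((hreg ▸ isOpen_interior : IsOpen Ω).interior_eq.symm ▸ cell_subset hreg ⟨K, hK⟩ h)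
  obtain ⟨a, ha⟩ : ∃ a, hsimplex.coord a x ≤ 0 := by
    simpa [hsimplex.mem_cell_iff] using hcell
  refine mem_iUnion.2 ⟨⟨face K a, face_mem_faces ⟨K, hK⟩ a⟩, hsimplex.mem_hull_face_iff.2 ⟨hxK, ?_⟩⟩
  exact ha.antisymm (hsimplex.mem_hull_iff.1 hxK a)

theorem isFiniteMeasure_restrict_frontier [NeZero d] (T : Triangulation Ω)
    (hreg : interior (closure Ω) = Ω) :
    IsFiniteMeasure ((μHE[d - 1] : Measure (Space d)).restrict (frontier Ω)) := by
  have hface (e : T.faces) : μHE[d - 1] (hull e.1) < ⊤ := by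
    simpa using integrableOn_face e (continuous_const (y := (1 : ℝ)))
  refine isFiniteMeasure_restrict.2 (ne_top_of_le_ne_top ?_
    (measure_mono (frontier_subset_iUnion_hull T hreg)))
  exact ((measure_iUnion_fintype_le _ _).trans_lt
    (ENNReal.sum_lt_top.2 fun e _ => hface e)).ne

end Integrability

end

end RTHybrid

theorem proposition3p1_general (d : ℕ) [NeZero d] (Ω : Set (RTHybrid.Space d))
    (hreg : interior (closure Ω) = Ω) (T : RTHybrid.Triangulation Ω) (k : ℕ)
    (κ f u₀ : RTHybrid.Space d → ℝ) (hκ : IntegrableOn (fun x => (κ x)⁻¹) Ω)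
    (hκpos : ∀ᵐ x ∂(volume.restrict Ω), 0 < κ x) (hf : IntegrableOn f Ω)
    (hu₀ : IntegrableOn u₀ (frontier Ω) (μHE[d - 1] : Measure (RTHybrid.Space d))) :
    (∃! s : RTHybrid.Vh T k × RTHybrid.Wh T k × RTHybrid.Mh T k,
      RTHybrid.IsHybridSolution T k κ f u₀ s.1 s.2.1 s.2.2) ∧
    (∀ (q : RTHybrid.Vh T k) (u : RTHybrid.Wh T k) (uhat : RTHybrid.Mh T k),
      RTHybrid.IsHybridSolution T k κ f u₀ q u uhat →
        RTHybrid.IsGalerkinSolution T k κ f u₀ q u) ∧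
    (∀ (q : RTHybrid.Vh T k) (u : RTHybrid.Wh T k),
      RTHybrid.IsGalerkinSolution T k κ f u₀ q u →
        ∃ uhat : RTHybrid.Mh T k, RTHybrid.IsHybridSolution T k κ f u₀ q u uhat) :=
  ⟨RTHybrid.existsUnique_isHybridSolution hreg hκ hκpos hf hu₀,
    fun _ _ _ h => h.isGalerkinSolution hreg hκ hf hu₀,
    fun _ _ h => h.exists_isHybridSolution hreg hκ hκpos hf hu₀⟩

theorem proposition3p1 (d : ℕ) (hd : 2 ≤ d)
    (Ω : Set (RTHybrid.Space d)) (hopen : IsOpen Ω) (hconn : IsConnected Ω)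
    (hreg : interior (closure Ω) = Ω)
    (T : RTHybrid.Triangulation Ω) (k : ℕ)
    (κ f u₀ : RTHybrid.Space d → ℝ)
    (hκ : MemLp κ ⊤ (volume.restrict Ω))
    (hκpos : ∃ κ₀ : ℝ, 0 < κ₀ ∧ ∀ᵐ x ∂(volume.restrict Ω), κ₀ ≤ κ x)
    (hf : MemLp f 2 (volume.restrict Ω))
    (hu₀ : MemLp u₀ 2 ((μHE[d - 1] : Measure (RTHybrid.Space d)).restrict (frontier Ω))) :
    (∃! s : RTHybrid.Vh T k × RTHybrid.Wh T k × RTHybrid.Mh T k,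
      RTHybrid.IsHybridSolution T k κ f u₀ s.1 s.2.1 s.2.2) ∧
    (∀ (q : RTHybrid.Vh T k) (u : RTHybrid.Wh T k) (uhat : RTHybrid.Mh T k),
      RTHybrid.IsHybridSolution T k κ f u₀ q u uhat →
        RTHybrid.IsGalerkinSolution T k κ f u₀ q u) ∧
    (∀ (q : RTHybrid.Vh T k) (u : RTHybrid.Wh T k),
      RTHybrid.IsGalerkinSolution T k κ f u₀ q u →
        ∃ uhat : RTHybrid.Mh T k, RTHybrid.IsHybridSolution T k κ f u₀ q u uhat) := by
  have : NeZero d := ⟨by omega⟩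
  have := RTHybrid.isFiniteMeasure_restrict_domain T
  have := RTHybrid.isFiniteMeasure_restrict_frontier T hreg
  obtain ⟨κ₀, hκ₀, hle⟩ := hκpos
  exact proposition3p1_general d Ω hreg T k κ f u₀ (RTHybrid.integrableOn_inv_of_le T hκ.1 hκ₀ hle)
    (hle.mono fun _ => hκ₀.trans_le) (hf.integrable one_le_two) (hu₀.integrable one_le_two)
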